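/- Let $E/\mathbb{Q}$ be an elliptic curve given by a (not necessarily minimal) Weierstrass equation $y^2+a_1xy+a_3y=x^3+a_2x^2+a_4x+a_6$ with $a_i\in\mathbb{Z}$, and let $P\in E(\mathbb{Q})$ be a point of infinite order. For a prime $p$ let $E_0(\mathbb{Q}_p)$ be the group of points of $E(\mathbb{Q}_p)$ whose reduction modulo $p$ (with respect to the given equation) is nonsingular, and for $i\ge 1$ let $E_i(\mathbb{Q}_p)=\{Q\in E_0(\mathbb{Q}_p): Q\equiv O \bmod p^i\}$, where $O=(0:1:0)$. Put $v_p(Q)=\sup\{i: Q\in E_i(\mathbb{Q}_p)\}$ if $Q\in E_1(\mathbb{Q}_p)$ and $v_p(Q)=0$ otherwise, and for $Q\in E_0(\mathbb{Q}_p)$ and $i\ge1$ let $\operatorname{ord}(Q\bmod p^i)$ be the order of the image of $Q$ in $E_0(\mathbb{Q}_p)/E_i(\mathbb{Q}_p)$. Let $\psi_n$ ($n\in\mathbb{Z}$) be the division polynomials of the given equation. For $n\ne0$ write $nP=(a_n/e_n^2,\,b_n/e_n^3)$ with integers $a_n,b_n,e_n$, $\gcd(a_nb_n,e_n)=1$ and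 $e_n>0$, and set $$\beta_0=0,\qquad \beta_n=\operatorname{sign}(\psi_n(P))\,\frac{e_n}{e_1}\quad(n\in\mathbb{Z}\setminus\{0\}).$$ Let $M=\operatorname{lcm}\{\operatorname{ord}(P+E_0(\mathbb{Q}_p)): p\text{ prime}\}$, where $\operatorname{ord}(P+E_0(\mathbb{Q}_p))$ is the order of the image of $P$ in the finite group $E(\mathbb{Q}_p)/E_0(\mathbb{Q}_p)$; that is, $M$ is the least positive integer such that $MP\in E_0(\mathbb{Q}_p)$ for all primes $p$. Then all $\beta_n$ are integers, and the following holds. Let $p$ be a prime and $k\ge1$ an integer, and let $$r(p^k)=M\cdot\operatorname{ord}\bigl(MP\bmod p^{\,k+v_p(MP)}\bigr),$$ $$\pi(p^k)=\begin{cases}(p-1)p^{k-1}r(p^k),&\text{if }p\ne2\text{ and }\left(\dfrac{\beta_{M+r(p^k)}\,\beta_{M-r(p^k)}}{p}\right)=1,\\[2mm] 2(p-1)p^{k-1}r(p^k),&\text{otherwise,}\end{cases}$$ where $\left(\frac{\cdot}{p}\right)$ is the Legendre symbol. Then $\pi(p^k)$ is a (finite) positive integer, and for all $m,n\in\mathbb{Z}$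 $$m\equiv n \bmod \pi(p^k)\ \Longrightarrow\ \beta_m\equiv\beta_n \bmod p^k,$$ i.e. the sequence $\beta_n\bmod p^k$ is periodic with period dividing $\pi(p^k)$. Consequently $\beta_n$ is periodic modulo every positive integer $N$: there is an integer $T\ge1$ such that $m\equiv n\bmod T$ implies $\beta_m\equiv\beta_n\bmod N$. -/

import Mathlib

/-- `OrderModulo S Q` is the order of the class of `Q` in the quotient by the subgroup with
underlying set `S`, i.e. the least `n ≥ 1` with `n • Q ∈ S` (and `0` if there is none). -/
noncomputable def OrderModulo {A : Type*} [AddCommGroup A] (S : Set A) (Q : A) : ℕ :=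
  sInf {n : ℕ | 0 < n ∧ n • Q ∈ S}

namespace WeierstrassCurve

/-! ### Elliptic curves over `ℚ_p` given by an integral Weierstrass equation -/

section Local

variable (W : WeierstrassCurve ℤ) (p : ℕ) [Fact p.Prime]

/-- The homogeneous coordinates `v = (X, Y, Z)` lie in `ℤ_p`, are not all divisible by `p`, and
represent the point `Q ∈ E(ℚ_p) ⊆ ℙ²(ℚ_p)`. Reducing such coordinates modulo `p ^ i` gives the
image of `Q` in `ℙ²(ℤ_p / p ^ i)`. -/
def IsPrimitiveRep : (W.baseChange ℚ_[p]).toAffine.Point → (Fin 3 → ℤ_[p]) → Prop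
  | .zero, v => IsUnit (v 1) ∧ v 0 = 0 ∧ v 2 = 0
  | .some x y _, v => (∃ j, IsUnit (v j)) ∧ v 2 ≠ 0 ∧
      (v 0 : ℚ_[p]) = x * (v 2 : ℚ_[p]) ∧ (v 1 : ℚ_[p]) = y * (v 2 : ℚ_[p])

/-- `E_0(ℚ_p)`: the points whose reduction modulo `p` is a nonsingular point of the reduced
(projective) Weierstrass curve over `𝔽_p`. -/
def nonsingularReduction : Set (W.baseChange ℚ_[p]).toAffine.Point :=
  {Q | ∃ v : Fin 3 → ℤ_[p], IsPrimitiveRep W p Q v ∧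
    (W.map (Int.castRingHom (ZMod p))).toProjective.Nonsingular
      (fun j => PadicInt.toZMod (v j))}

/-- `E_i(ℚ_p) = {Q ∈ E_0(ℚ_p) : Q ≡ O mod p ^ i}`, where `O = (0 : 1 : 0)`
(for `i = 0` the congruence is empty and this is `E_0(ℚ_p)`). -/
def padicFiltration (i : ℕ) : Set (W.baseChange ℚ_[p]).toAffine.Point :=
  {Q | Q ∈ nonsingularReduction W p ∧ ∃ v : Fin 3 → ℤ_[p], IsPrimitiveRep W p Q v ∧
    (p : ℤ_[p]) ^ i ∣ v 0 ∧ (p : ℤ_[p]) ^ i ∣ v 2}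

/-- `v_p(Q) = sup {i : Q ∈ E_i(ℚ_p)}` for `Q ∈ E_1(ℚ_p)`, and `v_p(Q) = 0` for `Q ∉ E_1(ℚ_p)`
(the supremum of `{0}` or of `∅`). The value at `Q = O`, where the supremum is infinite,
is meaningless. -/
noncomputable def pointVal (Q : (W.baseChange ℚ_[p]).toAffine.Point) : ℕ :=
  sSup {i : ℕ | Q ∈ padicFiltration W p i}

open scoped Classical in
/-- A rational point, seen in `E(ℚ_p)`. -/
noncomputable def toPadicPoint (P : (W.baseChange ℚ).toAffine.Point) :
    (W.baseChange ℚ_[p]).toAffine.Point :=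
  Affine.Point.baseChange (W' := W.toAffine) ℚ ℚ_[p] P

open scoped Classical in
/-- The order of the image of `P` in `E(ℚ_p) / E_0(ℚ_p)`. -/
noncomputable def componentOrder (P : (W.baseChange ℚ).toAffine.Point) : ℕ :=
  OrderModulo (nonsingularReduction W p) (toPadicPoint W p P)

open scoped Classical in
/-- `ord(Q mod p ^ i)`: the order of the image of `Q` in `E_0(ℚ_p) / E_i(ℚ_p)`,
for a rational point `Q` in `E_0(ℚ_p)`. -/
noncomputable def orderModPow (i : ℕ) (Q : (W.baseChange ℚ).toAffine.Point) : ℕ :=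
  OrderModulo (padicFiltration W p i) (toPadicPoint W p Q)

end Local

/-! ### The elliptic divisibility sequence of a rational point -/

section Global

variable (W : WeierstrassCurve ℤ)

/-- `e` is a denominator of `Q`: `Q = (a / e ^ 2, b / e ^ 3)` with integers `a`, `b`, `e > 0`
and `gcd(a b, e) = 1`. -/
def IsDenominator : (W.baseChange ℚ).toAffine.Point → ℕ → Prop
  | .zero, _ => False
  | .some x y _, e => 0 < e ∧ ∃ a b : ℤ, x = (a : ℚ) / (e : ℚ) ^ 2 ∧ y = (b : ℚ) / (e : ℚ) ^ 3 ∧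
      IsCoprime (a * b) (e : ℤ)

/-- The denominator of a rational point `Q ≠ O`: the unique `e` with `IsDenominator W Q e`. -/
noncomputable def denominator (Q : (W.baseChange ℚ).toAffine.Point) : ℕ :=
  sInf {e : ℕ | IsDenominator W Q e}

/-- The value `ψ_n(P)` of the `n`-th division polynomial at an affine rational point. -/
noncomputable def psiAt (n : ℤ) : (W.baseChange ℚ).toAffine.Point → ℚ
  | .zero => 0
  | .some x y _ => ((W.baseChange ℚ).ψ n).evalEval x y

/-- The sequence `β_n = sign(ψ_n(P)) e_n / e_1`, `β_0 = 0`, where `e_n` is the denominator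
of `n P`. -/
noncomputable def edsb (P : (W.baseChange ℚ).toAffine.Point) (n : ℤ) : ℚ :=
  if n = 0 then 0
  else ((SignType.sign (psiAt W n P) : SignType) : ℚ) *
    (denominator W (n • P) : ℚ) / (denominator W P : ℚ)

/-- `M(P) = lcm {ord(P + E_0(ℚ_p)) : p prime}`, the least common multiple being the least
positive integer that is divisible by all these orders. -/
noncomputable def goodMultiple (P : (W.baseChange ℚ).toAffine.Point) : ℕ :=
  sInf {m : ℕ | 0 < m ∧ ∀ (p : ℕ) [Fact p.Prime], componentOrder W p P ∣ m}

/-- `r(p ^ k) = M ord(M P mod p ^ (k + v_p(M P)))`. -/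
noncomputable def edsbRank (P : (W.baseChange ℚ).toAffine.Point) (p : ℕ) [Fact p.Prime]
    (k : ℕ) : ℕ :=
  goodMultiple W P *
    orderModPow W p (k + pointVal W p (toPadicPoint W p (goodMultiple W P • P)))
      (goodMultiple W P • P)

/-- `π(p ^ k)`, for the sequence of integers `β` attached to `P`. -/
noncomputable def edsbPeriod (P : (W.baseChange ℚ).toAffine.Point) (β : ℤ → ℤ)
    (p : ℕ) [Fact p.Prime] (k : ℕ) : ℕ :=
  if p ≠ 2 ∧ legendreSym p (β ((goodMultiple W P : ℤ) + (edsbRank W P p k : ℤ)) *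
      β ((goodMultiple W P : ℤ) - (edsbRank W P p k : ℤ))) = 1 then
    (p - 1) * p ^ (k - 1) * edsbRank W P p k
  else
    2 * (p - 1) * p ^ (k - 1) * edsbRank W P p k

end Global

end WeierstrassCurve

/-! Write `a_Q = xNum Q` and `e_Q = xDen Q`, so that `x(Q) = a_Q / e_Q²` in lowest terms, with the
pair `(1, 0)` at `O`. The pair `x(P + Q)`, `x(P - Q)` consists of the roots of a quadratic whose
coefficients are biquadratic forms in the coordinates of `x(P)` and `x(Q)`. Evaluated at integers in
lowest terms (`exists_int_addSub`), these forms carry a common factor `g`, and a prime dividing `g`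
makes the reduction of `Q` singular (`not_dvd_of_isGoodAt`). If `mP` is nonsingular modulo every
prime, nothing is lost, and the leading form gives `|a_n e_m² - a_m e_n²| = e_{n+m} e_{n-m}`. The
division polynomials satisfy `ψ_{n+m} ψ_{n-m} = (x_m - x_n) ψ_n² ψ_m²`, which fixes the signs, so
`β_{n+m} β_{n-m} = a_m β_n² - a_n β_m²` (`eds_add_mul_eds_sub`).

Take `m = r = r(p^k)`. Then `p^k ∣ β_r` and `A = a_r` is prime to `p`, so `β_{n+r} β_{n-r} ≡ A β_n²
mod p^(2k)`. Along `n + t r` the `p`-adic valuation, truncated at `k`, is constant. Once the common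
power of `p` is removed, the terms are units with constant second quotient `A`, hence of the form
`B_0 (B_1 / B_0)^t A^(t choose 2)`. At `t = N` the first power is trivial when `φ(p^k) ∣ N`, and it
remains to have `A^(N choose 2) ≡ 1` (`dvd_sub_of_mul_sub_sq`). `N = 2 φ(p^k)` always works. `N =
φ(p^k)` works for odd `p` if `A` is a square modulo `p`, which the Legendre symbol detects because
`β_{M+r} β_{M-r} ≡ A β_M² mod p`. Composite moduli follow by the Chinese remainder theorem. -/

namespace WeierstrassCurve

/-! ### Biquadratic forms for `x(P + Q)` and `x(P - Q)` -/

section Forms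

variable {R : Type*} [CommRing R] (W : WeierstrassCurve R)

/-- The first of the biquadratic forms `(1, x(P + Q) + x(P - Q), x(P + Q) x(P - Q))`, up to a
common factor, in homogeneous coordinates `(X₁ : Z₁) = x(P)` and `(X₂ : Z₂) = x(Q)`. -/
def addSubDen (X₁ Z₁ X₂ Z₂ : R) : R := (X₁ * Z₂ - X₂ * Z₁) ^ 2

/-- The biquadratic form of the sum `x(P + Q) + x(P - Q)`. -/
def addSubSum (X₁ Z₁ X₂ Z₂ : R) : R :=
  2 * X₁ * X₂ * (X₁ * Z₂ + X₂ * Z₁) + W.b₂ * X₁ * X₂ * Z₁ * Z₂ +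
    W.b₄ * (X₁ * Z₂ + X₂ * Z₁) * Z₁ * Z₂ + W.b₆ * Z₁ ^ 2 * Z₂ ^ 2

/-- The biquadratic form of the product `x(P + Q) x(P - Q)`. -/
def addSubProd (X₁ Z₁ X₂ Z₂ : R) : R :=
  X₁ ^ 2 * X₂ ^ 2 - W.b₄ * X₁ * X₂ * Z₁ * Z₂ - W.b₆ * (X₁ * Z₂ + X₂ * Z₁) * Z₁ * Z₂ -
    W.b₈ * Z₁ ^ 2 * Z₂ ^ 2

/-- The denominator of the duplication map on `x`-coordinates. -/
def dblDen (X Z : R) : R :=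
  4 * X ^ 3 * Z + W.b₂ * X ^ 2 * Z ^ 2 + 2 * W.b₄ * X * Z ^ 3 + W.b₆ * Z ^ 4

/-- The numerator of the duplication map on `x`-coordinates. -/
def dblNum (X Z : R) : R :=
  X ^ 4 - W.b₄ * X ^ 2 * Z ^ 2 - 2 * W.b₆ * X * Z ^ 3 - W.b₈ * Z ^ 4

lemma addSubSum_self (X Z : R) : W.addSubSum X Z X Z = W.dblDen X Z := by
  simp only [addSubSum, dblDen]; ring

lemma addSubProd_self (X Z : R) : W.addSubProd X Z X Z = W.dblNum X Z := by
  simp only [addSubProd, dblNum]; ring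

/-- The resultant identity behind the coprimality of `dblDen` and `dblNum`. -/
lemma Δ_mul_pow_eq (X Z : R) : W.Δ * Z ^ 7 =
    W.dblDen X Z * (X * (-(W.b₂ * Z + 12 * X) ^ 2 +
        32 * (W.b₄ * Z ^ 2 + W.b₂ * X * Z + 6 * X ^ 2)) +
      (W.b₂ * Z + 12 * X) * (W.b₄ * Z ^ 2 + W.b₂ * X * Z + 6 * X ^ 2) -
      27 * (4 * X ^ 3 + W.b₂ * X ^ 2 * Z + 2 * W.b₄ * X * Z ^ 2 + W.b₆ * Z ^ 3)) -
    W.dblNum X Z * (Z * (-(W.b₂ * Z + 12 * X) ^ 2 +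
        32 * (W.b₄ * Z ^ 2 + W.b₂ * X * Z + 6 * X ^ 2))) := by
  have h := W.b_relation
  simp only [dblDen, dblNum, Δ]
  grind

/-- The left side is the square of half the derivative of `dblDen x 1`. At a common zero of `dblDen`
and `dblNum` this derivative term therefore vanishes too, in every characteristic. -/
lemma b₄_shift_sq (x : R) : (W.b₄ + W.b₂ * x + 6 * x ^ 2) ^ 2 =
    (W.b₂ + 12 * x) * W.dblDen x 1 - 4 * (x * W.dblDen x 1 - W.dblNum x 1) := by
  have h := W.b_relation
  simp only [dblDen, dblNum]
  grind

/-- Taylor expansion about `x`. When `x` is the abscissa of a singular point, every term but the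
square drops out. -/
lemma addSub_eval (x X₁ Z₁ X₂ Z₂ : R) :
    addSubDen X₁ Z₁ X₂ Z₂ * x ^ 2 - W.addSubSum X₁ Z₁ X₂ Z₂ * x + W.addSubProd X₁ Z₁ X₂ Z₂ =
    ((X₁ - x * Z₁) * (X₂ - x * Z₂)) ^ 2 -
    (W.b₄ + W.b₂ * x + 6 * x ^ 2) * (X₁ - x * Z₁) * (X₂ - x * Z₂) * Z₁ * Z₂ -
    W.dblDen x 1 * ((X₁ - x * Z₁) * Z₂ + (X₂ - x * Z₂) * Z₁) * Z₁ * Z₂ -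
    (x * W.dblDen x 1 - W.dblNum x 1) * Z₁ ^ 2 * Z₂ ^ 2 := by
  simp only [addSubDen, addSubSum, addSubProd, dblDen, dblNum]
  ring

end Forms

namespace Affine.Point

variable {F : Type*} [Field F] [DecidableEq F] {W : Affine F}

/-- The forms `addSubDen`, `addSubSum` and `addSubProd` compute the unordered pair
`{x(P + Q), x(P - Q)}`. -/
lemma exists_addSub (P Q : W.Point) : ∃ c : F,
    addSubDen (P.xRep 0) (P.xRep 1) (Q.xRep 0) (Q.xRep 1) =
      c * ((P + Q).xRep 1 * (P - Q).xRep 1) ∧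
    WeierstrassCurve.addSubSum W (P.xRep 0) (P.xRep 1) (Q.xRep 0) (Q.xRep 1) =
      c * ((P + Q).xRep 0 * (P - Q).xRep 1 + (P - Q).xRep 0 * (P + Q).xRep 1) ∧
    WeierstrassCurve.addSubProd W (P.xRep 0) (P.xRep 1) (Q.xRep 0) (Q.xRep 1) =
      c * ((P + Q).xRep 0 * (P - Q).xRep 0) := by
  -- The diagonal case, where the difference is `O = (1 : 0)`. The scalar is `dblNum` when `P + P =
  -- O` and `dblDen` when `P + P` is affine.
  have dbl (P : W.Point) : ∃ c : F,
      0 = c * ((P + P).xRep 1 * 0) ∧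
      WeierstrassCurve.dblDen W (P.xRep 0) (P.xRep 1) = c * (P + P).xRep 1 ∧
      WeierstrassCurve.dblNum W (P.xRep 0) (P.xRep 1) = c * (P + P).xRep 0 := by
    rcases P with _ | ⟨x, y, h⟩
    · exact ⟨1, by simp [← zero_def, dblDen, dblNum]⟩
    have h' := h
    rw [nonsingular_iff, equation_iff] at h'
    obtain ⟨he, -⟩ := h'
    by_cases hy : y = W.negY x y
    · refine ⟨WeierstrassCurve.dblNum W x 1, ?_⟩
      rw [add_self_of_Y_eq hy]
      simp only [negY] at hy
      refine ⟨by simp, ?_, by simp⟩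
      simp [dblDen, b₂, b₄, b₆]
      grind
    · refine ⟨WeierstrassCurve.dblDen W x 1, ?_⟩
      rw [add_self_of_Y_ne hy]
      simp only [xRep_some, slope_of_Y_ne rfl hy]
      simp only [negY] at hy ⊢
      have hη : y - (-y - W.a₁ * x - W.a₃) ≠ 0 := sub_ne_zero.2 hy
      refine ⟨by simp, by simp, ?_⟩
      have hd : WeierstrassCurve.dblDen W x 1 = (y - (-y - W.a₁ * x - W.a₃)) ^ 2 := by
        simp [dblDen, b₂, b₄, b₆]
        grind
      rw [hd]
      have h₆ : W.a₆ = y ^ 2 + W.a₁ * x * y + W.a₃ * y -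
          (x ^ 3 + W.a₂ * x ^ 2 + W.a₄ * x) := by linear_combination -he
      simp only [dblNum, addX, Matrix.cons_val_zero, Matrix.cons_val_one, b₄, b₆, b₈]
      rw [h₆]
      generalize hη' : y - (-y - W.a₁ * x - W.a₃) = η at hη ⊢
      field_simp
      subst hη'
      ring
  rcases P with _ | ⟨x₁, y₁, h₁⟩
  · exact ⟨1, by simp [← zero_def, addSubDen, pow_two], by simp [← zero_def, addSubSum]; ring,
      by simp [← zero_def, addSubProd, pow_two]⟩
  rcases Q with _ | ⟨x₂, y₂, h₂⟩
  · exact ⟨1, by simp [← zero_def, addSubDen, pow_two], by simp [← zero_def, addSubSum]; ring,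
      by simp [← zero_def, addSubProd, pow_two]⟩
  by_cases hx : x₁ = x₂
  · rcases X_eq_iff.1 hx with h | h
    · rw [h, sub_self]
      obtain ⟨c, -, hc₁, hc₂⟩ := dbl (some x₂ y₂ h₂)
      refine ⟨c, by simp [addSubDen], ?_, ?_⟩
      · rw [addSubSum_self, hc₁]; simp
      · rw [addSubProd_self, hc₂]; simp
    · rw [h, sub_eq_add_neg, ← neg_add, neg_add_cancel, xRep_neg, xRep_neg]
      obtain ⟨c, -, hc₁, hc₂⟩ := dbl (some x₂ y₂ h₂)
      refine ⟨c, by simp [addSubDen], ?_, ?_⟩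
      · rw [addSubSum_self, hc₁]; simp
      · rw [addSubProd_self, hc₂]; simp
  · refine ⟨(x₁ - x₂) ^ 2, ?_⟩
    have hd : x₁ - x₂ ≠ 0 := sub_ne_zero.2 hx
    have e₁ := (nonsingular_iff _ _).1 h₁ |>.1
    have e₂ := (nonsingular_iff _ _).1 h₂ |>.1
    rw [equation_iff] at e₁ e₂
    rw [sub_eq_add_neg (some x₁ y₁ h₁), neg_some, add_of_X_ne hx, add_of_X_ne hx]
    simp only [xRep_some, slope_of_X_ne hx]
    refine ⟨by simp [addSubDen], ?_, ?_⟩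
    · simp [addSubSum, addX, negY, b₂, b₄, b₆]
      field_simp
      linear_combination (-2) * e₁ + (-2) * e₂
    -- Solving the two curve equations for `a₄` and `a₆` turns the claim into an identity of
    -- rational functions in the remaining variables.
    · have h₄ : W.a₄ = (y₁ ^ 2 + W.a₁ * x₁ * y₁ + W.a₃ * y₁ - x₁ ^ 3 - W.a₂ * x₁ ^ 2 -
          (y₂ ^ 2 + W.a₁ * x₂ * y₂ + W.a₃ * y₂ - x₂ ^ 3 - W.a₂ * x₂ ^ 2)) / (x₁ - x₂) := by
        field_simp
        linear_combination e₂ - e₁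
      have h₆ : W.a₆ = y₁ ^ 2 + W.a₁ * x₁ * y₁ + W.a₃ * y₁ -
          (x₁ ^ 3 + W.a₂ * x₁ ^ 2 + W.a₄ * x₁) := by linear_combination -e₁
      simp [addSubProd, addX, negY, b₄, b₆, b₈]
      rw [h₆, h₄]
      field_simp
      ring

end Affine.Point
end WeierstrassCurve

lemma Prime.pow_dvd_or_pow_dvd_of_sq_dvd_mul {p a b : ℤ} (hp : Prime p) {i : ℕ}
    (h : p ^ (2 * i) ∣ a * b) : p ^ i ∣ a ∨ p ^ i ∣ b := by
  rw [pow_dvd_iff_le_emultiplicity, emultiplicity_mul hp] at h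
  simp only [pow_dvd_iff_le_emultiplicity]
  by_contra! hc
  obtain ⟨h₁, h₂⟩ := hc
  generalize emultiplicity p a = u at *
  generalize emultiplicity p b = v at *
  lift u to ℕ using h₁.ne_top
  lift v to ℕ using h₂.ne_top
  norm_cast at *
  omega

/-! ### Rational points in lowest terms -/

/-- A rational point of an integral Weierstrass equation has coordinates with denominators
`e ^ 2` and `e ^ 3`. -/
lemma WeierstrassCurve.exists_den_eq (W : WeierstrassCurve ℤ) {x y : ℚ}
    (h : (W.baseChange ℚ).toAffine.Equation x y) :
    ∃ e : ℕ, x.den = e ^ 2 ∧ y.den = e ^ 3 := by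
  rw [Affine.equation_iff] at h
  simp only [baseChange, map_a₁, map_a₂, map_a₃, map_a₄, map_a₆, algebraMap_int_eq,
    eq_intCast] at h
  have hx : (x.den : ℤ) ≠ 0 := by exact_mod_cast x.den_nz
  have hy : (y.den : ℤ) ≠ 0 := by exact_mod_cast y.den_nz
  have cx : IsCoprime (x.den : ℤ) x.num := by
    rw [Int.isCoprime_iff_gcd_eq_one]; simpa [Int.gcd, Nat.coprime_comm] using x.reduced.symm
  have cy : IsCoprime (y.den : ℤ) y.num := by
    rw [Int.isCoprime_iff_gcd_eq_one]; simpa [Int.gcd, Nat.coprime_comm] using y.reduced.symm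
  have key : y.num ^ 2 * x.den ^ 3 + W.a₁ * x.num * y.num * y.den * x.den ^ 2 +
      W.a₃ * y.num * y.den * x.den ^ 3 = (y.den : ℤ) ^ 2 * (x.num ^ 3 + W.a₂ * x.num ^ 2 * x.den +
        W.a₄ * x.num * x.den ^ 2 + W.a₆ * x.den ^ 3) := by
    have hx' : (x.den : ℚ) ≠ 0 := by exact_mod_cast x.den_nz
    have hy' : (y.den : ℚ) ≠ 0 := by exact_mod_cast y.den_nz
    rw [← Rat.num_div_den x, ← Rat.num_div_den y] at h
    field_simp at h
    have : ((y.num ^ 2 * x.den ^ 3 + W.a₁ * x.num * y.num * y.den * x.den ^ 2 +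
      W.a₃ * y.num * y.den * x.den ^ 3 : ℤ) : ℚ) = ((y.den : ℤ) ^ 2 * (x.num ^ 3 +
        W.a₂ * x.num ^ 2 * x.den + W.a₄ * x.num * x.den ^ 2 + W.a₆ * x.den ^ 3) : ℤ) := by
      push_cast
      linear_combination h
    exact_mod_cast this
  generalize x.num = A at *
  generalize y.num = B at *
  generalize hd : (x.den : ℤ) = d at *
  generalize hD : (y.den : ℤ) = D at *
  -- With `d` and `D` the denominators of `x` and `y`, the cubic numerator `U` is prime to `d`.
  -- Divisibility in `key` gives `D = d g`, then `d = g f` with `f = ± g`; hence `d = ± g²` and `D =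
  -- ± g³`.
  obtain ⟨U, hU⟩ : ∃ U, A ^ 3 + W.a₂ * A ^ 2 * d + W.a₄ * A * d ^ 2 + W.a₆ * d ^ 3 = U := ⟨_, rfl⟩
  have cU : IsCoprime d U := by
    have : U = A ^ 3 + d * (W.a₂ * A ^ 2 + W.a₄ * A * d + W.a₆ * d ^ 2) := by rw [← hU]; ring
    rw [this]
    exact cx.pow_right.add_mul_left_right _
  rw [hU] at key
  have h₁ : d ∣ D := by
    have : d ^ 2 ∣ D ^ 2 * U := ⟨B ^ 2 * d + W.a₁ * A * B * D + W.a₃ * B * D * d, by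
      rw [← key]; ring⟩
    exact (Int.pow_dvd_pow_iff two_ne_zero).1 ((cU.pow_left).dvd_of_dvd_mul_right this)
  obtain ⟨g, rfl⟩ := h₁
  have k₁ : B ^ 2 * d + W.a₁ * A * B * g * d + W.a₃ * B * g * d ^ 2 = g ^ 2 * U :=
    mul_left_cancel₀ (pow_ne_zero 2 hx) (by linear_combination key)
  have cg : IsCoprime g (B ^ 2) := (cy.of_mul_left_right).pow_right
  have h₂ : g ∣ d := by
    have : g ∣ B ^ 2 * d := ⟨g * U - W.a₁ * A * B * d - W.a₃ * B * d ^ 2, by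
      linear_combination k₁⟩
    exact cg.dvd_of_dvd_mul_left this
  obtain ⟨f, rfl⟩ := h₂
  have hg : g ≠ 0 := left_ne_zero_of_mul hx
  have k₂ : B ^ 2 * f + W.a₁ * A * B * g * f + W.a₃ * B * g ^ 2 * f ^ 2 = g * U :=
    mul_left_cancel₀ hg (by linear_combination k₁)
  have h₃ : g ∣ f := by
    have : g ∣ B ^ 2 * f := ⟨U - W.a₁ * A * B * f - W.a₃ * B * g * f ^ 2, by
      linear_combination k₂⟩
    exact cg.dvd_of_dvd_mul_left this
  have h₄ : f ∣ g := by
    have : f ∣ g * U := ⟨B ^ 2 + W.a₁ * A * B * g + W.a₃ * B * g ^ 2 * f, by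
      linear_combination -k₂⟩
    exact (cU.of_mul_left_right).dvd_of_dvd_mul_right this
  have hfg : f.natAbs = g.natAbs :=
    Nat.dvd_antisymm (Int.natAbs_dvd_natAbs.2 h₄) (Int.natAbs_dvd_natAbs.2 h₃)
  refine ⟨g.natAbs, ?_, ?_⟩
  · have := congrArg Int.natAbs hd
    rw [Int.natAbs_mul, hfg] at this
    simpa [pow_two] using this
  · have := congrArg Int.natAbs hD
    rw [Int.natAbs_mul, Int.natAbs_mul, hfg] at this
    simpa [pow_succ, mul_assoc] using this

namespace WeierstrassCurve

variable {W : WeierstrassCurve ℤ}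

/-- The numerator of the `x`-coordinate of a rational point, with value `1` at infinity. -/
def xNum : (W.baseChange ℚ).toAffine.Point → ℤ
  | .zero => 1
  | .some x _ _ => x.num

/-- The square root of the denominator of the `x`-coordinate of a rational point,
with value `0` at infinity. -/
def xDen : (W.baseChange ℚ).toAffine.Point → ℕ
  | .zero => 0
  | .some x _ _ => x.den.sqrt

lemma xNum_zero : xNum (0 : (W.baseChange ℚ).toAffine.Point) = 1 := rfl

lemma xDen_zero : xDen (0 : (W.baseChange ℚ).toAffine.Point) = 0 := rfl

lemma xDen_neg (Q : (W.baseChange ℚ).toAffine.Point) : xDen (-Q) = xDen Q := by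
  cases Q <;> rfl

lemma xDen_some {x y : ℚ} (h : (W.baseChange ℚ).toAffine.Nonsingular x y) :
    xDen (.some x y h) ^ 2 = x.den ∧ xDen (.some x y h) ^ 3 = y.den := by
  obtain ⟨e, h₁, h₂⟩ := W.exists_den_eq h.1
  have : xDen (.some x y h) = e := by simp [xDen, h₁, Nat.sqrt_eq']
  rw [this]
  exact ⟨h₁.symm, h₂.symm⟩

lemma xDen_pos {Q : (W.baseChange ℚ).toAffine.Point} (hQ : Q ≠ 0) : 0 < xDen Q := by
  rcases Q with _ | ⟨x, y, h⟩
  · exact (hQ rfl).elim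
  · have := (xDen_some h).1
    have := x.den_pos
    by_contra! h0
    simp_all

lemma isCoprime_xNum_xDen (Q : (W.baseChange ℚ).toAffine.Point) :
    IsCoprime (xNum Q) (xDen Q : ℤ) := by
  rcases Q with _ | ⟨x, y, h⟩
  · exact isCoprime_one_left
  · have h₁ := (xDen_some h).1
    have : IsCoprime x.num ((xDen (.some x y h) : ℤ) ^ 2) := by
      have h₂ : ((xDen (.some x y h) : ℤ) ^ 2) = x.den := by exact_mod_cast h₁
      rw [h₂, Int.isCoprime_iff_gcd_eq_one]
      simpa [Int.gcd] using x.reduced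
    exact (IsCoprime.pow_right_iff two_pos).1 this

lemma isDenominator_iff {Q : (W.baseChange ℚ).toAffine.Point} (hQ : Q ≠ 0) (e : ℕ) :
    IsDenominator W Q e ↔ e = xDen Q := by
  rcases Q with _ | ⟨x, y, h⟩
  · exact (hQ rfl).elim
  have hpos := xDen_pos hQ
  obtain ⟨h₁, h₂⟩ := xDen_some h
  have c₁ := isCoprime_xNum_xDen (.some x y h)
  constructor
  · rintro ⟨he, a, b, hx, -, hc⟩
    have : x.den = e ^ 2 := by
      have h0 : (x.den : ℤ) = (e : ℤ) ^ 2 := by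
        have := Rat.den_div_eq_of_coprime (a := a) (b := (e : ℤ) ^ 2) (by positivity)
          (by
            have : IsCoprime a ((e : ℤ) ^ 2) := (hc.of_mul_left_left).pow_right
            rw [Int.isCoprime_iff_gcd_eq_one] at this
            simpa [Int.gcd] using this)
        rw [hx]
        push_cast at this
        exact this
      exact_mod_cast h0
    simp [xDen, this, Nat.sqrt_eq']
  · rintro rfl
    refine ⟨hpos, x.num, y.num, ?_, ?_, ?_⟩
    · conv_lhs => rw [← Rat.num_div_den x]
      rw [← h₁]; push_cast; rfl
    · conv_lhs => rw [← Rat.num_div_den y]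
      rw [← h₂]; push_cast; rfl
    · refine IsCoprime.mul_left c₁ ?_
      have : IsCoprime y.num ((xDen (.some x y h) : ℤ) ^ 3) := by
        have h₂ : ((xDen (.some x y h) : ℤ) ^ 3) = y.den := by exact_mod_cast h₂
        rw [h₂, Int.isCoprime_iff_gcd_eq_one]
        simpa [Int.gcd] using y.reduced
      exact (IsCoprime.pow_right_iff three_pos).1 this

lemma denominator_eq {Q : (W.baseChange ℚ).toAffine.Point} (hQ : Q ≠ 0) :
    denominator W Q = xDen Q := by
  simp [denominator, isDenominator_iff hQ]

lemma exists_xRep_scale (Q : (W.baseChange ℚ).toAffine.Point) : ∃ t : ℚ, t ≠ 0 ∧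
    (xNum Q : ℚ) = t * Q.xRep 0 ∧ (xDen Q : ℚ) ^ 2 = t * Q.xRep 1 := by
  rcases Q with _ | ⟨x, y, h⟩
  · exact ⟨1, one_ne_zero, by simp [xNum, ← Affine.Point.zero_def],
      by simp [xDen, ← Affine.Point.zero_def]⟩
  · have h₁ : (xDen (.some x y h) : ℚ) ^ 2 = x.den := by exact_mod_cast (xDen_some h).1
    refine ⟨x.den, by exact_mod_cast x.den_nz, ?_, ?_⟩
    · simp [xNum]
    · simp [h₁]

end WeierstrassCurve

/-! ### The forms over fields and at integral coordinates -/

namespace WeierstrassCurve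

section Map

variable {R S : Type*} [CommRing R] [CommRing S] (W : WeierstrassCurve R) (f : R →+* S)

lemma map_addSubDen (X₁ Z₁ X₂ Z₂ : R) :
    addSubDen (f X₁) (f Z₁) (f X₂) (f Z₂) = f (addSubDen X₁ Z₁ X₂ Z₂) := by
  simp [addSubDen]

lemma map_addSubSum (X₁ Z₁ X₂ Z₂ : R) :
    (W.map f).addSubSum (f X₁) (f Z₁) (f X₂) (f Z₂) = f (W.addSubSum X₁ Z₁ X₂ Z₂) := by
  simp [addSubSum, map_ofNat]

lemma map_addSubProd (X₁ Z₁ X₂ Z₂ : R) :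
    (W.map f).addSubProd (f X₁) (f Z₁) (f X₂) (f Z₂) = f (W.addSubProd X₁ Z₁ X₂ Z₂) := by
  simp [addSubProd]

lemma map_dblDen (X Z : R) : (W.map f).dblDen (f X) (f Z) = f (W.dblDen X Z) := by
  simp [dblDen, map_ofNat]

lemma map_dblNum (X Z : R) : (W.map f).dblNum (f X) (f Z) = f (W.dblNum X Z) := by
  simp [dblNum, map_ofNat]

end Map

section Field

variable {K : Type*} [Field K] (W : WeierstrassCurve K)

lemma dblDen_mul (u X Z : K) : W.dblDen (u * X) (u * Z) = u ^ 4 * W.dblDen X Z := by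
  simp only [dblDen]; ring

lemma dblNum_mul (u X Z : K) : W.dblNum (u * X) (u * Z) = u ^ 4 * W.dblNum X Z := by
  simp only [dblNum]; ring

/-- Vanishing of the leading form makes the two pairs proportional; the other two forms then
specialise to the duplication forms, up to a square. -/
lemma dblDen_eq_zero_and_dblNum_eq_zero_of_addSub {X₁ Z₁ X₂ Z₂ : K} (h₁ : X₁ ≠ 0 ∨ Z₁ ≠ 0)
    (hd : addSubDen X₁ Z₁ X₂ Z₂ = 0) (hs : W.addSubSum X₁ Z₁ X₂ Z₂ = 0)
    (hm : W.addSubProd X₁ Z₁ X₂ Z₂ = 0) : W.dblDen X₂ Z₂ = 0 ∧ W.dblNum X₂ Z₂ = 0 := by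
  have hD : X₁ * Z₂ - X₂ * Z₁ = 0 := pow_eq_zero_iff two_ne_zero |>.1 hd
  obtain ⟨u, rfl, rfl⟩ : ∃ u, X₂ = u * X₁ ∧ Z₂ = u * Z₁ := by
    rcases h₁ with h | h
    · exact ⟨X₂ / X₁, by field_simp, by field_simp; linear_combination hD⟩
    · exact ⟨Z₂ / Z₁, by field_simp; linear_combination -hD, by field_simp⟩
  have e₁ : W.addSubSum X₁ Z₁ (u * X₁) (u * Z₁) = u ^ 2 * W.dblDen X₁ Z₁ := by
    simp only [addSubSum, dblDen]; ring
  have e₂ : W.addSubProd X₁ Z₁ (u * X₁) (u * Z₁) = u ^ 2 * W.dblNum X₁ Z₁ := by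
    simp only [addSubProd, dblNum]; ring
  rw [dblDen_mul, dblNum_mul, show u ^ 4 = u ^ 2 * u ^ 2 by ring, mul_assoc, mul_assoc, ← e₁, ← e₂,
    hs, hm]
  simp

/-- The fibre of the addition map over a singular point consists of singular points. -/
lemma dblDen_eq_zero_and_dblNum_eq_zero_of_root {x X₁ Z₁ X₂ Z₂ : K} (h₁ : W.dblDen x 1 = 0)
    (h₂ : W.dblNum x 1 = 0) (hx : addSubDen X₁ Z₁ X₂ Z₂ * x ^ 2 - W.addSubSum X₁ Z₁ X₂ Z₂ * x +
      W.addSubProd X₁ Z₁ X₂ Z₂ = 0) :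
    (W.dblDen X₁ Z₁ = 0 ∧ W.dblNum X₁ Z₁ = 0) ∨ (W.dblDen X₂ Z₂ = 0 ∧ W.dblNum X₂ Z₂ = 0) := by
  have h₃ := W.b₄_shift_sq x
  rw [h₁, h₂] at h₃
  have h₄ : W.b₄ + W.b₂ * x + 6 * x ^ 2 = 0 := by
    refine pow_eq_zero_iff two_ne_zero |>.1 (h₃.trans (by ring))
  rw [addSub_eval, h₁, h₂, h₄] at hx
  have h₅ : ((X₁ - x * Z₁) * (X₂ - x * Z₂)) ^ 2 = 0 := by linear_combination hx
  have key (X Z : K) (h : X - x * Z = 0) : W.dblDen X Z = 0 ∧ W.dblNum X Z = 0 := by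
    rw [sub_eq_zero.1 h, mul_comm x]
    have e₁ := W.dblDen_mul Z x 1
    have e₂ := W.dblNum_mul Z x 1
    rw [mul_one] at e₁ e₂
    rw [e₁, e₂, h₁, h₂]
    simp
  rcases mul_eq_zero.1 (pow_eq_zero_iff two_ne_zero |>.1 h₅) with h | h
  · exact .inl (key _ _ h)
  · exact .inr (key _ _ h)

end Field

variable {W : WeierstrassCurve ℤ}

/-- The denominator of `c` divides all three `uᵢ`, which have no common prime factor. -/
lemma exists_int_eq_mul_of_rat {c : ℚ} {f₀ f₁ f₂ u₀ u₁ u₂ : ℤ}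
    (hu : ∀ p : ℤ, Prime p → p ∣ u₀ → p ∣ u₁ → ¬ p ∣ u₂) (h₀ : (f₀ : ℚ) = c * u₀)
    (h₁ : (f₁ : ℚ) = c * u₁) (h₂ : (f₂ : ℚ) = c * u₂) :
    ∃ g : ℤ, f₀ = g * u₀ ∧ f₁ = g * u₁ ∧ f₂ = g * u₂ := by
  have hden : (c.den : ℚ) ≠ 0 := by exact_mod_cast c.den_nz
  have hcop : IsCoprime (c.den : ℤ) c.num := by
    rw [Int.isCoprime_iff_gcd_eq_one]; simpa [Int.gcd, Nat.coprime_comm] using c.reduced.symm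
  have key {f u : ℤ} (h : (f : ℚ) = c * u) : (c.den : ℤ) ∣ u := by
    refine hcop.dvd_of_dvd_mul_left ⟨f, ?_⟩
    rw [← Rat.num_div_den c] at h
    field_simp at h
    rw [mul_comm (c.den : ℤ)]
    exact_mod_cast h.symm
  have hc : c.den = 1 := by
    by_contra hne
    obtain ⟨p, hp, hpd⟩ := Nat.exists_prime_and_dvd hne
    have hpd' : (p : ℤ) ∣ c.den := by exact_mod_cast hpd
    exact hu p (Nat.prime_iff_prime_int.1 hp) (hpd'.trans (key h₀)) (hpd'.trans (key h₁))
      (hpd'.trans (key h₂))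
  have hc' : c = c.num := ((Rat.den_eq_one_iff c).1 hc).symm
  rw [hc'] at h₀ h₁ h₂
  exact ⟨c.num, by exact_mod_cast h₀, by exact_mod_cast h₁, by exact_mod_cast h₂⟩

/-- The forms `addSubDen`, `addSubSum` and `addSubProd` at two rational points, up to an integral
factor `g`. -/
lemma exists_int_addSub (P Q : (W.baseChange ℚ).toAffine.Point) : ∃ g : ℤ,
    addSubDen (xNum P) (xDen P ^ 2 : ℤ) (xNum Q) (xDen Q ^ 2 : ℤ) =
      g * (xDen (P + Q) ^ 2 * xDen (P - Q) ^ 2) ∧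
    W.addSubSum (xNum P) (xDen P ^ 2 : ℤ) (xNum Q) (xDen Q ^ 2 : ℤ) =
      g * (xNum (P + Q) * xDen (P - Q) ^ 2 + xNum (P - Q) * xDen (P + Q) ^ 2) ∧
    W.addSubProd (xNum P) (xDen P ^ 2 : ℤ) (xNum Q) (xDen Q ^ 2 : ℤ) =
      g * (xNum (P + Q) * xNum (P - Q)) := by
  obtain ⟨c, hd, hs, hm⟩ := Affine.Point.exists_addSub P Q
  obtain ⟨t₁, ht₁, a₁, b₁⟩ := exists_xRep_scale P
  obtain ⟨t₂, ht₂, a₂, b₂⟩ := exists_xRep_scale Q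
  obtain ⟨t₃, ht₃, a₃, b₃⟩ := exists_xRep_scale (P + Q)
  obtain ⟨t₄, ht₄, a₄, b₄⟩ := exists_xRep_scale (P - Q)
  have Hd := map_addSubDen (algebraMap ℤ ℚ) (xNum P) (xDen P ^ 2 : ℤ) (xNum Q) (xDen Q ^ 2 : ℤ)
  have Hs := W.map_addSubSum (algebraMap ℤ ℚ) (xNum P) (xDen P ^ 2 : ℤ) (xNum Q) (xDen Q ^ 2 : ℤ)
  have Hm := W.map_addSubProd (algebraMap ℤ ℚ) (xNum P) (xDen P ^ 2 : ℤ) (xNum Q) (xDen Q ^ 2 : ℤ)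
  simp only [eq_intCast, Int.cast_pow, Int.cast_natCast, a₁, b₁, a₂, b₂]
    at Hd Hs Hm
  generalize addSubDen (xNum P) (xDen P ^ 2 : ℤ) (xNum Q) (xDen Q ^ 2 : ℤ) = f₀ at *
  generalize W.addSubSum (xNum P) (xDen P ^ 2 : ℤ) (xNum Q) (xDen Q ^ 2 : ℤ) = f₁ at *
  generalize W.addSubProd (xNum P) (xDen P ^ 2 : ℤ) (xNum Q) (xDen Q ^ 2 : ℤ) = f₂ at *
  have c₃ := isCoprime_xNum_xDen (P + Q)
  have c₄ := isCoprime_xNum_xDen (P - Q)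
  have hc (a b : ℚ) : t₁ ^ 2 * t₂ ^ 2 * (c * (a * b)) =
      t₁ ^ 2 * t₂ ^ 2 * c / (t₃ * t₄) * ((t₃ * a) * (t₄ * b)) := by field_simp
  have hmul : ∀ u v w z : ℚ, addSubDen (t₁ * u) (t₁ * v) (t₂ * w) (t₂ * z) =
      t₁ ^ 2 * t₂ ^ 2 * addSubDen u v w z ∧
      (W.map (algebraMap ℤ ℚ)).addSubSum (t₁ * u) (t₁ * v) (t₂ * w) (t₂ * z) =
      t₁ ^ 2 * t₂ ^ 2 * (W.map (algebraMap ℤ ℚ)).addSubSum u v w z ∧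
      (W.map (algebraMap ℤ ℚ)).addSubProd (t₁ * u) (t₁ * v) (t₂ * w) (t₂ * z) =
      t₁ ^ 2 * t₂ ^ 2 * (W.map (algebraMap ℤ ℚ)).addSubProd u v w z := fun u v w z ↦
    ⟨by simp only [addSubDen]; ring, by simp only [addSubSum]; ring,
      by simp only [addSubProd]; ring⟩
  obtain ⟨m₀, m₁, m₂⟩ := hmul (P.xRep 0) (P.xRep 1) (Q.xRep 0) (Q.xRep 1)
  -- The forms have degree two in each pair of coordinates, whence `t₁² t₂²`; passing to lowest
  -- terms for `P + Q` and `P - Q` costs `t₃ t₄`.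
  refine exists_int_eq_mul_of_rat (c := t₁ ^ 2 * t₂ ^ 2 * c / (t₃ * t₄)) ?_ ?_ ?_ ?_
  -- Gauss's lemma: the three values are the coefficients of a product of two primitive linear
  -- forms.
  · intro p hp h₀ h₁ h₂
    have hz (X Z : ℤ) (hXZ : IsCoprime X Z) (hX : p ∣ X) : ¬ p ∣ Z ^ 2 := fun h ↦
      hp.not_isUnit (hXZ.isUnit_of_dvd' hX (hp.dvd_of_dvd_pow h))
    rcases hp.dvd_or_dvd h₂ with h | h
    · have := (dvd_add_right (h.mul_right _)).1 h₁
      rcases hp.dvd_or_dvd this with h' | h'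
      · rcases hp.dvd_or_dvd h₀ with h'' | h''
        · exact hz _ _ c₃ h h''
        · exact hz _ _ c₄ h' h''
      · exact hz _ _ c₃ h h'
    · have := (dvd_add_left (h.mul_right _)).1 h₁
      rcases hp.dvd_or_dvd this with h' | h'
      · rcases hp.dvd_or_dvd h₀ with h'' | h''
        · exact hz _ _ c₃ h' h''
        · exact hz _ _ c₄ h h''
      · exact hz _ _ c₄ h h'
  · push_cast
    rw [b₃, b₄, ← Hd, m₀, hd, hc]
  · push_cast
    rw [b₃, b₄, a₃, a₄, ← Hs, m₁]
    erw [hs]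
    rw [mul_add c, mul_add, hc, hc]
    field_simp
  · push_cast
    rw [a₃, a₄, ← Hm, m₂]
    erw [hm]
    rw [hc]

/-! ### Nonsingular reduction and the filtration near `O` -/

/-- A rational point has nonsingular reduction modulo `p` with respect to the equation `W`. -/
def IsGoodAt (p : ℕ) (Q : (W.baseChange ℚ).toAffine.Point) : Prop :=
  ¬ ((p : ℤ) ∣ W.dblDen (xNum Q) (xDen Q ^ 2 : ℤ) ∧ (p : ℤ) ∣ W.dblNum (xNum Q) (xDen Q ^ 2 : ℤ))

section Good

variable {p : ℕ} {P Q : (W.baseChange ℚ).toAffine.Point}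

lemma not_dvd_xNum (hp : p.Prime) (h : (p : ℤ) ∣ xDen Q) : ¬ (p : ℤ) ∣ xNum Q := fun h' ↦
  (Nat.prime_iff_prime_int.1 hp).not_isUnit ((isCoprime_xNum_xDen Q).isUnit_of_dvd' h' h)

/-- Such a point reduces to `O`: modulo `p`, `dblNum` becomes the fourth power of the numerator, a
unit. -/
lemma isGoodAt_of_dvd_xDen (hp : p.Prime) (h : (p : ℤ) ∣ xDen Q) : IsGoodAt p Q := by
  rintro ⟨-, h₂⟩
  refine not_dvd_xNum hp h ((Nat.prime_iff_prime_int.1 hp).dvd_of_dvd_pow (n := 4) ?_)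
  obtain ⟨k, hk⟩ := h
  rw [hk] at h₂
  simp only [dblNum] at h₂
  obtain ⟨l, hl⟩ := h₂
  exact ⟨l + (W.b₄ * xNum Q ^ 2 * (p * k ^ 2) ^ 2 * p + 2 * W.b₆ * xNum Q * (p * k ^ 2) ^ 3 * p ^ 2 +
    W.b₈ * (p * k ^ 2) ^ 4 * p ^ 3), by linear_combination hl⟩

lemma isGoodAt_zero (hp : p.Prime) : IsGoodAt p (0 : (W.baseChange ℚ).toAffine.Point) :=
  isGoodAt_of_dvd_xDen hp (by simp [xDen_zero])

lemma natCast_dvd_dbl_iff [Fact p.Prime] (X Z : ℤ) :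
    ((p : ℤ) ∣ W.dblDen X Z ∧ (p : ℤ) ∣ W.dblNum X Z) ↔
      (W.map (Int.castRingHom (ZMod p))).dblDen (X : ZMod p) (Z : ZMod p) = 0 ∧
      (W.map (Int.castRingHom (ZMod p))).dblNum (X : ZMod p) (Z : ZMod p) = 0 := by
  have h₁ := W.map_dblDen (Int.castRingHom (ZMod p)) X Z
  have h₂ := W.map_dblNum (Int.castRingHom (ZMod p)) X Z
  simp only [eq_intCast] at h₁ h₂
  rw [h₁, h₂, ZMod.intCast_zmod_eq_zero_iff_dvd, ZMod.intCast_zmod_eq_zero_iff_dvd]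

/-- If `p ∣ g`, all three forms vanish modulo `p`, while the coordinates of `P` do not both vanish;
so both duplication forms vanish at `Q`. Only `Q` has to be good. -/
lemma not_dvd_of_isGoodAt (hp : p.Prime) (hQ : IsGoodAt p Q) {g : ℤ}
    (hd : g ∣ addSubDen (xNum P) (xDen P ^ 2 : ℤ) (xNum Q) (xDen Q ^ 2 : ℤ))
    (hs : g ∣ W.addSubSum (xNum P) (xDen P ^ 2 : ℤ) (xNum Q) (xDen Q ^ 2 : ℤ))
    (hm : g ∣ W.addSubProd (xNum P) (xDen P ^ 2 : ℤ) (xNum Q) (xDen Q ^ 2 : ℤ)) :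
    ¬ (p : ℤ) ∣ g := by
  intro hg
  have := Fact.mk hp
  refine hQ ((natCast_dvd_dbl_iff _ _).2 ?_)
  have hz {n : ℤ} (h : g ∣ n) : (n : ZMod p) = 0 :=
    (ZMod.intCast_zmod_eq_zero_iff_dvd _ _).2 (hg.trans h)
  have Hd := map_addSubDen (Int.castRingHom (ZMod p)) (xNum P) (xDen P ^ 2 : ℤ) (xNum Q)
    (xDen Q ^ 2 : ℤ)
  have Hs := W.map_addSubSum (Int.castRingHom (ZMod p)) (xNum P) (xDen P ^ 2 : ℤ) (xNum Q)
    (xDen Q ^ 2 : ℤ)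
  have Hm := W.map_addSubProd (Int.castRingHom (ZMod p)) (xNum P) (xDen P ^ 2 : ℤ) (xNum Q)
    (xDen Q ^ 2 : ℤ)
  simp only [eq_intCast] at Hd Hs Hm
  refine dblDen_eq_zero_and_dblNum_eq_zero_of_addSub _ ?_ (Hd.trans (hz hd)) (Hs.trans (hz hs))
    (Hm.trans (hz hm))
  by_contra! hc
  rw [ZMod.intCast_zmod_eq_zero_iff_dvd, ZMod.intCast_zmod_eq_zero_iff_dvd] at hc
  exact not_dvd_xNum hp ((Nat.prime_iff_prime_int.1 hp).dvd_of_dvd_pow hc.2) hc.1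

/-- The points with nonsingular reduction are closed under addition. -/
lemma IsGoodAt.add (hp : p.Prime) (hP : IsGoodAt p P) (hQ : IsGoodAt p Q) :
    IsGoodAt p (P + Q) := by
  have := Fact.mk hp
  by_contra hbad
  have hbad' := hbad
  rw [IsGoodAt, not_not, natCast_dvd_dbl_iff] at hbad
  obtain ⟨b₁, b₂⟩ := hbad
  have hZ : ((xDen (P + Q) ^ 2 : ℤ) : ZMod p) ≠ 0 := by
    rw [Ne, ZMod.intCast_zmod_eq_zero_iff_dvd]
    exact fun h ↦ hbad' (isGoodAt_of_dvd_xDen hp ((Nat.prime_iff_prime_int.1 hp).dvd_of_dvd_pow h))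
  obtain ⟨g, hd, hs, hm⟩ := exists_int_addSub P Q
  -- `x(P + Q)` is a root of the quadratic. If it reduces to a singular abscissa, then so does
  -- `x(P)` or `x(Q)`.
  have hroot : addSubDen (xNum P) (xDen P ^ 2 : ℤ) (xNum Q) (xDen Q ^ 2 : ℤ) * xNum (P + Q) ^ 2 -
      W.addSubSum (xNum P) (xDen P ^ 2 : ℤ) (xNum Q) (xDen Q ^ 2 : ℤ) * xNum (P + Q) *
        (xDen (P + Q) ^ 2 : ℤ) +
      W.addSubProd (xNum P) (xDen P ^ 2 : ℤ) (xNum Q) (xDen Q ^ 2 : ℤ) *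
        (xDen (P + Q) ^ 2 : ℤ) ^ 2 = 0 := by
    rw [hd, hs, hm]; ring
  have hroot' := congrArg (Int.castRingHom (ZMod p)) hroot
  have hP' := hP
  have hQ' := hQ
  rw [IsGoodAt, natCast_dvd_dbl_iff] at hP' hQ'
  simp only [map_add, map_sub, map_mul, map_pow (Int.castRingHom (ZMod p)) _ 2, map_zero,
    ← map_addSubDen, ← map_addSubSum, ← map_addSubProd] at hroot'
  simp only [eq_intCast] at hroot'
  push_cast at *
  generalize (xDen (P + Q) : ZMod p) ^ 2 = Z at *
  generalize (xNum (P + Q) : ZMod p) = X at *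
  have e₁ := (W.map (Int.castRingHom (ZMod p))).dblDen_mul Z (X / Z) 1
  have e₂ := (W.map (Int.castRingHom (ZMod p))).dblNum_mul Z (X / Z) 1
  rw [mul_one, mul_div_cancel₀ _ hZ] at e₁ e₂
  rw [e₁] at b₁
  rw [e₂] at b₂
  rcases dblDen_eq_zero_and_dblNum_eq_zero_of_root _ ((mul_eq_zero_iff_left (by positivity)).1 b₁)
    ((mul_eq_zero_iff_left (by positivity)).1 b₂) (x := X / Z) (by
      field_simp
      linear_combination hroot') with h | h
  · exact hP' h
  · exact hQ' h

lemma IsGoodAt.nsmul (hp : p.Prime) (hP : IsGoodAt p P) (n : ℕ) : IsGoodAt p (n • P) := by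
  induction n with
  | zero => simpa using isGoodAt_zero hp
  | succ n ih => rw [succ_nsmul]; exact ih.add hp hP

/-- The points that reduce to the point at infinity modulo `p ^ i` are closed under addition. -/
lemma pow_dvd_xDen_add (hp : p.Prime) {i : ℕ} (hP : (p : ℤ) ^ i ∣ xDen P)
    (hQ : (p : ℤ) ^ i ∣ xDen Q) : (p : ℤ) ^ i ∣ xDen (P + Q) := by
  have hp' := Nat.prime_iff_prime_int.1 hp
  rcases Nat.eq_zero_or_pos i with rfl | hi
  · simp
  obtain ⟨g, hd, hs, hm⟩ := exists_int_addSub P Q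
  have hg := not_dvd_of_isGoodAt hp (isGoodAt_of_dvd_xDen hp ((dvd_pow_self _ hi.ne').trans hQ))
    (hd ▸ dvd_mul_right _ _) (hs ▸ dvd_mul_right _ _) (hm ▸ dvd_mul_right _ _)
  have hZ {n : ℤ} (h : (p : ℤ) ^ i ∣ n) : (p : ℤ) ^ (2 * i) ∣ n ^ 2 := by
    rw [mul_comm, pow_mul]
    exact pow_dvd_pow_of_dvd h 2
  -- Since `p ∤ g`, the leading form puts `p^i` into the denominator of `P + Q` or of `P - Q`. In
  -- the latter case the middle form transfers it to `P + Q`, the numerator of `P - Q` being prime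
  -- to `p`.
  have hd' : (p : ℤ) ^ (2 * i) ∣ xDen (P + Q) * xDen (P - Q) := by
    rw [← Int.pow_dvd_pow_iff two_ne_zero, ← pow_mul]
    refine hp'.pow_dvd_of_dvd_mul_left _ hg ?_
    rw [mul_pow, ← hd, addSubDen, pow_mul]
    exact pow_dvd_pow_of_dvd (dvd_sub (hZ hQ |>.mul_left _) (hZ hP |>.mul_left _)) 2
  have hs' : (p : ℤ) ^ (2 * i) ∣
      xNum (P + Q) * xDen (P - Q) ^ 2 + xNum (P - Q) * xDen (P + Q) ^ 2 := by
    refine hp'.pow_dvd_of_dvd_mul_left _ hg ?_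
    rw [← hs, addSubSum]
    refine dvd_add (dvd_add (dvd_add ?_ ?_) ?_) ?_
    · exact Dvd.dvd.mul_left (dvd_add (hZ hQ |>.mul_left _) (hZ hP |>.mul_left _)) _
    · exact hZ hQ |>.mul_left _
    · exact hZ hQ |>.mul_left _
    · exact (dvd_pow (hZ hQ) two_ne_zero).mul_left _
  rcases hp'.pow_dvd_or_pow_dvd_of_sq_dvd_mul hd' with h | h
  · exact h
  have h₁ : (p : ℤ) ^ (2 * i) ∣ xNum (P - Q) * xDen (P + Q) ^ 2 := by
    exact (dvd_add_right (hZ h |>.mul_left _)).1 hs'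
  have h₂ := hp'.pow_dvd_of_dvd_mul_left _
    (not_dvd_xNum hp ((dvd_pow_self _ hi.ne').trans h)) h₁
  rwa [mul_comm, pow_mul, Int.pow_dvd_pow_iff two_ne_zero] at h₂

end Good

end WeierstrassCurve

lemma Prime.pow_dvd_right_of_not_pow_dvd_left {p x y : ℤ} (hp : Prime p) {a b : ℕ}
    (h : p ^ (a + b) ∣ x * y) (hx : ¬ p ^ (a + 1) ∣ x) : p ^ b ∣ y := by
  rw [pow_dvd_iff_le_emultiplicity] at *
  rw [emultiplicity_mul hp] at h
  rw [not_le] at hx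
  generalize emultiplicity p x = u at *
  generalize emultiplicity p y = v at *
  lift u to ℕ using hx.ne_top
  by_cases hv : v = ⊤
  · simp [hv]
  lift v to ℕ using hv
  norm_cast at *
  omega

/-! ### Everywhere good points, the discriminant, and multiples close to `O` -/

namespace WeierstrassCurve

variable {W : WeierstrassCurve ℤ}

lemma Δ_ne_zero_of_isElliptic_baseChange [h : (W.baseChange ℚ).IsElliptic] : W.Δ ≠ 0 := by
  have := h.isUnit.ne_zero
  rw [baseChange, map_Δ] at this
  exact fun h0 ↦ this (by simp [h0])

/-- No prime divides `g`, so `g = ± 1`, and the leading form is an equality of squares. The sign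
`-1` can occur only when both sides are zero. -/
lemma sub_eq_xDen_mul_xDen {P Q : (W.baseChange ℚ).toAffine.Point}
    (hQ : ∀ p : ℕ, p.Prime → IsGoodAt p Q) :
    |xNum P * (xDen Q : ℤ) ^ 2 - xNum Q * (xDen P : ℤ) ^ 2| = xDen (P + Q) * xDen (P - Q) := by
  obtain ⟨g, hd, hs, hm⟩ := exists_int_addSub P Q
  have hg : g.natAbs = 1 := by
    by_contra hne
    obtain ⟨p, hp, hpd⟩ := Nat.exists_prime_and_dvd hne
    exact not_dvd_of_isGoodAt hp (hQ p hp) (hd ▸ dvd_mul_right _ _) (hs ▸ dvd_mul_right _ _)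
      (hm ▸ dvd_mul_right _ _) (Int.natCast_dvd.2 hpd)
  rw [addSubDen] at hd
  rw [← abs_of_nonneg (a := (xDen (P + Q) * xDen (P - Q) : ℤ)) (by positivity), ← sq_eq_sq_iff_abs_eq_abs]
  rcases Int.natAbs_eq g with h | h <;> rw [hg] at h <;> subst h
  · rw [hd]; push_cast; ring
  · have h₀ : (xDen (P + Q) * xDen (P - Q) : ℤ) ^ 2 = 0 := by
      refine le_antisymm ?_ (sq_nonneg _)
      have := sq_nonneg (xNum P * (xDen Q : ℤ) ^ 2 - xNum Q * (xDen P : ℤ) ^ 2)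
      rw [hd] at this
      push_cast at this
      linarith
    rw [hd, h₀, ← mul_pow, h₀, mul_zero]

/-- The greatest common divisor of the values of the duplication forms divides the
discriminant. -/
lemma pow_dvd_Δ {p : ℕ} (hp : p.Prime) {Q : (W.baseChange ℚ).toAffine.Point} {i : ℕ}
    (h₁ : (p : ℤ) ^ i ∣ W.dblDen (xNum Q) (xDen Q ^ 2 : ℤ))
    (h₂ : (p : ℤ) ^ i ∣ W.dblNum (xNum Q) (xDen Q ^ 2 : ℤ)) : (p : ℤ) ^ i ∣ W.Δ := by
  rcases Nat.eq_zero_or_pos i with rfl | hi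
  · simp
  have hp' := Nat.prime_iff_prime_int.1 hp
  have hpi : (p : ℤ) ∣ (p : ℤ) ^ i := dvd_pow_self _ hi.ne'
  have hz : ¬ (p : ℤ) ∣ ((xDen Q : ℤ) ^ 2) ^ 7 := fun h ↦
    isGoodAt_of_dvd_xDen hp (hp'.dvd_of_dvd_pow (hp'.dvd_of_dvd_pow h))
      ⟨hpi.trans h₁, hpi.trans h₂⟩
  refine hp'.pow_dvd_of_dvd_mul_right _ hz ?_
  rw [Δ_mul_pow_eq]
  exact dvd_sub (h₁.mul_right _) (h₂.mul_right _)

lemma isGoodAt_of_not_dvd_Δ {p : ℕ} (hp : p.Prime) (h : ¬ (p : ℤ) ∣ W.Δ)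
    (Q : (W.baseChange ℚ).toAffine.Point) : IsGoodAt p Q := fun ⟨h₁, h₂⟩ ↦
  h (by simpa using pow_dvd_Δ hp (i := 1) (by simpa using h₁) (by simpa using h₂))

/-- Some positive multiple of a rational point is arbitrarily close to `O` in the `p`-adic
topology. -/
lemma exists_pow_dvd_xDen_nsmul (hΔ : W.Δ ≠ 0) {p : ℕ} (hp : p.Prime)
    (P : (W.baseChange ℚ).toAffine.Point) (i : ℕ) :
    ∃ n : ℕ, 0 < n ∧ (p : ℤ) ^ i ∣ xDen (n • P) := by
  have hp' := Nat.prime_iff_prime_int.1 hp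
  obtain ⟨v, hv⟩ : ∃ v, ¬ (p : ℤ) ^ (v + 1) ∣ W.Δ := by
    obtain ⟨v, hv⟩ := FiniteMultiplicity.of_prime_left hp' hΔ
    exact ⟨v, hv⟩
  -- Pigeonhole modulo `p^s` gives two multiples with congruent coordinates. As `s ≥ v + 1`, a
  -- factor `p^(v+1)` of `g` would divide `Δ`. As `2s ≥ v + 4i`, the leading form still leaves
  -- `p^(4i)` for the squared denominators of their sum and difference.
  set s := 2 * i + v + 1 with hs
  have : NeZero (p ^ s) := ⟨pow_ne_zero _ hp.ne_zero⟩
  obtain ⟨n, m, hnm, heq⟩ := Finite.exists_ne_map_eq_of_infinite (fun n : ℕ ↦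
    ((xNum (n • P) : ZMod (p ^ s)), (((xDen (n • P) : ℤ) ^ 2 : ℤ) : ZMod (p ^ s))))
  rw [Prod.mk.injEq, ZMod.intCast_eq_intCast_iff, ZMod.intCast_eq_intCast_iff] at heq
  obtain ⟨g, hd, hS, hm⟩ := exists_int_addSub (m • P) (n • P)
  have key : ∀ {X₁ Z₁ X₂ Z₂ : ℤ}, X₁ ≡ X₂ [ZMOD (p ^ s : ℕ)] → Z₁ ≡ Z₂ [ZMOD (p ^ s : ℕ)] →
      ((p : ℤ) ^ s) ^ 2 ∣ addSubDen X₂ Z₂ X₁ Z₁ ∧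
      (p : ℤ) ^ s ∣ W.addSubSum X₂ Z₂ X₁ Z₁ - W.dblDen X₂ Z₂ ∧
      (p : ℤ) ^ s ∣ W.addSubProd X₂ Z₂ X₁ Z₁ - W.dblNum X₂ Z₂ := by
    intro X₁ Z₁ X₂ Z₂ hX hZ
    push_cast at hX hZ
    generalize (p : ℤ) ^ s = L at *
    refine ⟨pow_dvd_pow_of_dvd ?_ 2, ?_, ?_⟩
    · refine (Int.ModEq.dvd (n := L) ?_)
      gcongr
    · rw [← addSubSum_self]
      refine (Int.ModEq.dvd (n := L) ?_)
      simp only [addSubSum]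
      gcongr
    · rw [← addSubProd_self]
      refine (Int.ModEq.dvd (n := L) ?_)
      simp only [addSubProd]
      gcongr
  obtain ⟨k₀, k₁, k₂⟩ := key heq.1 heq.2
  rw [hd] at k₀
  rw [hS] at k₁
  rw [hm] at k₂
  have hg : ¬ (p : ℤ) ^ (v + 1) ∣ g := fun hg ↦ by
    have hle : (p : ℤ) ^ (v + 1) ∣ (p : ℤ) ^ s := pow_dvd_pow _ (by omega)
    exact hv (pow_dvd_Δ hp ((dvd_sub_right (hg.mul_right _)).1 (hle.trans k₁))
      ((dvd_sub_right (hg.mul_right _)).1 (hle.trans k₂)))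
  have h₁ : (p : ℤ) ^ (2 * i) ∣ xDen (m • P + n • P) * xDen (m • P - n • P) := by
    rw [← Int.pow_dvd_pow_iff two_ne_zero, ← pow_mul, mul_pow]
    refine hp'.pow_dvd_right_of_not_pow_dvd_left ((pow_dvd_pow _ ?_).trans (pow_mul (p : ℤ) s 2 ▸ k₀)) hg
    omega
  rcases hp'.pow_dvd_or_pow_dvd_of_sq_dvd_mul h₁ with h | h
  · exact ⟨m + n, by omega, by rwa [add_nsmul]⟩
  · rcases lt_or_gt_of_ne hnm with hlt | hlt
    · exact ⟨m - n, by omega, by rwa [sub_nsmul _ hlt.le, ← sub_eq_add_neg]⟩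
    · refine ⟨n - m, by omega, ?_⟩
      rwa [sub_nsmul _ hlt.le, ← sub_eq_add_neg, ← xDen_neg, neg_sub]

end WeierstrassCurve

/-! ### Translating `E_0(ℚ_p)` and `E_i(ℚ_p)` into divisibility of integers -/

namespace WeierstrassCurve

/-- On the curve `dblDen` is the square of the `y`-partial derivative, and `dblNum` is the square of
the `x`-partial derivative up to multiples of the `y`-partial. Hence the criterion holds in every
characteristic. -/
lemma nonsingular_iff_dbl {K : Type*} [Field K] (W : WeierstrassCurve K) {x y : K}
    (h : W.toAffine.Equation x y) :
    W.toAffine.Nonsingular x y ↔ ¬ (W.dblDen x 1 = 0 ∧ W.dblNum x 1 = 0) := by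
  rw [Affine.nonsingular_iff, and_iff_right h]
  rw [Affine.equation_iff] at h
  have h₁ : W.dblDen x 1 = (y - (-y - W.a₁ * x - W.a₃)) ^ 2 := by
    simp only [dblDen, b₂, b₄, b₆]
    linear_combination (-4) * h
  have h₂ : W.dblNum x 1 = (W.a₁ * y - (3 * x ^ 2 + 2 * W.a₂ * x + W.a₄)) ^ 2 -
      W.a₁ * (W.a₁ * y - (3 * x ^ 2 + 2 * W.a₂ * x + W.a₄)) * (y - (-y - W.a₁ * x - W.a₃)) -
      (W.a₂ + 2 * x) * (y - (-y - W.a₁ * x - W.a₃)) ^ 2 := by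
    have h₆ : W.a₆ = y ^ 2 + W.a₁ * x * y + W.a₃ * y -
        (x ^ 3 + W.a₂ * x ^ 2 + W.a₄ * x) := by linear_combination -h
    simp only [dblNum, b₄, b₆, b₈]
    rw [h₆]
    ring
  rw [h₁, h₂, ← not_and_or, not_iff_not, ← sub_eq_zero (a := W.a₁ * y), ← sub_eq_zero (a := y)]
  constructor
  · rintro ⟨e₁, e₂⟩
    rw [e₁, e₂]
    simp
  · rintro ⟨e₁, e₂⟩
    have e₁ := pow_eq_zero_iff two_ne_zero |>.1 e₁
    rw [e₁] at e₂
    exact ⟨pow_eq_zero_iff two_ne_zero |>.1 (by linear_combination e₂), e₁⟩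

variable {W : WeierstrassCurve ℤ} {p : ℕ} [Fact p.Prime]

lemma isUnit_intCast_padicInt_iff (k : ℤ) : IsUnit (k : ℤ_[p]) ↔ ¬ (p : ℤ) ∣ k := by
  rw [PadicInt.isUnit_iff, ← PadicInt.norm_int_lt_one_iff_dvd, not_lt]
  exact ⟨fun h ↦ h.ge, fun h ↦ le_antisymm (PadicInt.norm_le_one _) h⟩

lemma padicInt_not_isUnit_iff (z : ℤ_[p]) : ¬ IsUnit z ↔ PadicInt.toZMod z = 0 := by
  rw [← RingHom.mem_ker, PadicInt.ker_toZMod]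
  exact (IsLocalRing.mem_maximalIdeal z).symm

lemma toPadicPoint_some {x y : ℚ} (h : (W.baseChange ℚ).toAffine.Nonsingular x y) :
    ∃ h', toPadicPoint W p (.some x y h) = .some (x : ℚ_[p]) (y : ℚ_[p]) h' := by
  have hx : Algebra.ofId ℚ ℚ_[p] x = (x : ℚ_[p]) := eq_ratCast (algebraMap ℚ ℚ_[p]) x
  have hy : Algebra.ofId ℚ ℚ_[p] y = (y : ℚ_[p]) := eq_ratCast (algebraMap ℚ ℚ_[p]) y
  refine ⟨?_, ?_⟩
  · rw [← hx, ← hy]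
    exact (W.toAffine.baseChange_nonsingular (Algebra.ofId ℚ ℚ_[p]).injective ..).2 h
  · simp only [toPadicPoint, Affine.Point.baseChange, Affine.Point.map_some, hx, hy]

/-- The numerator of the `y`-coordinate of a rational point. -/
def yNum : (W.baseChange ℚ).toAffine.Point → ℤ
  | .zero => 1
  | .some _ y _ => y.num

variable {Q : (W.baseChange ℚ).toAffine.Point}

lemma isCoprime_yNum_xDen (hQ : Q ≠ 0) : IsCoprime (yNum Q) (xDen Q : ℤ) := by
  rcases Q with _ | ⟨x, y, h⟩
  · exact (hQ rfl).elim
  have : IsCoprime y.num ((xDen (.some x y h) : ℤ) ^ 3) := by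
    have h₂ : ((xDen (.some x y h) : ℤ) ^ 3) = y.den := by exact_mod_cast (xDen_some h).2
    rw [h₂, Int.isCoprime_iff_gcd_eq_one]
    simpa [Int.gcd] using y.reduced
  exact (IsCoprime.pow_right_iff three_pos).1 this

lemma yNum_equation (hQ : Q ≠ 0) :
    yNum Q ^ 2 + W.a₁ * xNum Q * yNum Q * xDen Q + W.a₃ * yNum Q * xDen Q ^ 3 =
      xNum Q ^ 3 + W.a₂ * xNum Q ^ 2 * xDen Q ^ 2 + W.a₄ * xNum Q * xDen Q ^ 4 +
        W.a₆ * xDen Q ^ 6 := by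
  have hpos := xDen_pos hQ
  rcases Q with _ | ⟨x, y, h⟩
  · exact (hQ rfl).elim
  obtain ⟨h₁, h₂⟩ := xDen_some h
  have he := h.1
  rw [Affine.equation_iff] at he
  simp only [baseChange, map_a₁, map_a₂, map_a₃, map_a₄, map_a₆, algebraMap_int_eq,
    eq_intCast] at he
  change y.num ^ 2 + W.a₁ * x.num * y.num * _ + W.a₃ * y.num * _ =
    x.num ^ 3 + W.a₂ * x.num ^ 2 * _ + W.a₄ * x.num * _ + _
  rw [← Rat.num_div_den x, ← Rat.num_div_den y, ← h₁, ← h₂] at he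
  generalize xDen (.some x y h) = e at *
  have he0 : (e : ℚ) ≠ 0 := by positivity
  push_cast at he
  field_simp at he
  have : ((y.num ^ 2 + W.a₁ * x.num * y.num * e + W.a₃ * y.num * e ^ 3 : ℤ) : ℚ) =
      (x.num ^ 3 + W.a₂ * x.num ^ 2 * e ^ 2 + W.a₄ * x.num * e ^ 4 + W.a₆ * e ^ 6 : ℤ) := by
    push_cast
    linear_combination he
  exact_mod_cast this

/-- The homogeneous coordinates of a rational point, up to a factor. -/
lemma isPrimitiveRep_iff (hQ : Q ≠ 0) (v : Fin 3 → ℤ_[p]) :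
    IsPrimitiveRep W p (toPadicPoint W p Q) v ↔ (∃ j, IsUnit (v j)) ∧ v 2 ≠ 0 ∧
      v 0 * xDen Q ^ 2 = (xNum Q : ℤ_[p]) * v 2 ∧ v 1 * xDen Q ^ 3 = (yNum Q : ℤ_[p]) * v 2 := by
  have hpos := xDen_pos hQ
  rcases Q with _ | ⟨x, y, h⟩
  · exact (hQ rfl).elim
  obtain ⟨h', hh⟩ := toPadicPoint_some (p := p) h
  rw [hh, IsPrimitiveRep]
  obtain ⟨h₁, h₂⟩ := xDen_some h
  change _ ↔ _ ∧ _ ∧ _ = (x.num : ℤ_[p]) * _ ∧ _ = (y.num : ℤ_[p]) * _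
  have he0 : (xDen (.some x y h) : ℚ_[p]) ≠ 0 := by exact_mod_cast hpos.ne'
  have hx : (x : ℚ_[p]) = x.num / (xDen (.some x y h) : ℚ_[p]) ^ 2 := by
    rw [Rat.cast_def, ← h₁]; push_cast; rfl
  have hy : (y : ℚ_[p]) = y.num / (xDen (.some x y h) : ℚ_[p]) ^ 3 := by
    rw [Rat.cast_def, ← h₂]; push_cast; rfl
  rw [hx, hy]
  generalize xDen (.some x y h) = e at *
  refine and_congr_right fun _ ↦ and_congr_right fun _ ↦ and_congr ?_ ?_
  · rw [div_mul_eq_mul_div, eq_div_iff (pow_ne_zero _ he0)]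
    norm_cast
    exact Subtype.ext_iff.symm
  · rw [div_mul_eq_mul_div, eq_div_iff (pow_ne_zero _ he0)]
    norm_cast
    exact Subtype.ext_iff.symm

lemma nonsingular_toZMod_iff (hQ : Q ≠ 0) (he : ¬ (p : ℤ) ∣ xDen Q) {v : Fin 3 → ℤ_[p]}
    (hv : IsUnit (v 2)) (h₀ : v 0 * xDen Q ^ 2 = (xNum Q : ℤ_[p]) * v 2)
    (h₁ : v 1 * xDen Q ^ 3 = (yNum Q : ℤ_[p]) * v 2) :
    (W.map (Int.castRingHom (ZMod p))).toProjective.Nonsingular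
      (fun j ↦ PadicInt.toZMod (v j)) ↔ IsGoodAt p Q := by
  have hz : PadicInt.toZMod (v 2) ≠ 0 := fun h ↦ (padicInt_not_isUnit_iff _).2 h hv
  rw [Projective.nonsingular_of_Z_ne_zero hz]
  have he' : (xDen Q : ZMod p) ≠ 0 := fun h ↦ he (by
    exact_mod_cast (ZMod.natCast_eq_zero_iff _ _).1 h)
  have e₀ := congrArg PadicInt.toZMod h₀
  have e₁ := congrArg PadicInt.toZMod h₁
  simp only [map_mul, map_pow, map_intCast, map_natCast] at e₀ e₁
  have hX : PadicInt.toZMod (v 0) / PadicInt.toZMod (v 2) =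
      (xNum Q : ZMod p) / (xDen Q : ZMod p) ^ 2 := by
    field_simp; linear_combination e₀
  have hY : PadicInt.toZMod (v 1) / PadicInt.toZMod (v 2) =
      (yNum Q : ZMod p) / (xDen Q : ZMod p) ^ 3 := by
    field_simp; linear_combination e₁
  rw [hX, hY]
  have heq : (W.map (Int.castRingHom (ZMod p))).toAffine.Equation
      ((xNum Q : ZMod p) / (xDen Q : ZMod p) ^ 2) ((yNum Q : ZMod p) / (xDen Q : ZMod p) ^ 3) := by
    rw [Affine.equation_iff]
    have := congrArg (Int.cast : ℤ → ZMod p) (yNum_equation hQ)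
    push_cast at this
    simp only [map_a₁, map_a₂, map_a₃, map_a₄, map_a₆, eq_intCast]
    field_simp
    linear_combination this
  rw [nonsingular_iff_dbl _ heq, IsGoodAt, natCast_dvd_dbl_iff]
  have hsq : (xDen Q : ZMod p) ^ 2 ≠ 0 := pow_ne_zero _ he'
  have d₁ := (W.map (Int.castRingHom (ZMod p))).dblDen_mul ((xDen Q : ZMod p) ^ 2)
    ((xNum Q : ZMod p) / (xDen Q : ZMod p) ^ 2) 1
  have d₂ := (W.map (Int.castRingHom (ZMod p))).dblNum_mul ((xDen Q : ZMod p) ^ 2)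
    ((xNum Q : ZMod p) / (xDen Q : ZMod p) ^ 2) 1
  rw [mul_one, mul_div_cancel₀ _ hsq] at d₁ d₂
  push_cast
  rw [d₁, d₂, mul_eq_zero_iff_left (pow_ne_zero _ hsq), mul_eq_zero_iff_left (pow_ne_zero _ hsq)]

lemma exists_isPrimitiveRep (hQ : Q ≠ 0) : IsPrimitiveRep W p (toPadicPoint W p Q)
    ![xNum Q * xDen Q, yNum Q, xDen Q ^ 3] := by
  have hpos := xDen_pos hQ
  rw [isPrimitiveRep_iff hQ]
  refine ⟨?_, ?_, ?_, ?_⟩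
  · by_cases h : (p : ℤ) ∣ xDen Q
    · refine ⟨1, (isUnit_intCast_padicInt_iff _).2 fun h' ↦ ?_⟩
      exact (Nat.prime_iff_prime_int.1 Fact.out).not_isUnit
        ((isCoprime_yNum_xDen hQ).isUnit_of_dvd' h' h)
    · exact ⟨2, by simpa using ((isUnit_intCast_padicInt_iff _).2 h).pow 3⟩
  · simpa using hpos.ne'
  · simp; ring
  · simp

/-- If `p` divides the denominator, the reduction is `O` and both sides hold. Otherwise every
primitive representative has a unit last coordinate, and the affine criterion applies. -/
lemma mem_nonsingularReduction_iff (hQ : Q ≠ 0) :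
    toPadicPoint W p Q ∈ nonsingularReduction W p ↔ IsGoodAt p Q := by
  have hp : p.Prime := Fact.out
  have hrep := exists_isPrimitiveRep (p := p) hQ
  by_cases he : (p : ℤ) ∣ xDen Q
  · refine iff_of_true ⟨_, hrep, ?_⟩ (isGoodAt_of_dvd_xDen hp he)
    have he' : (xDen Q : ZMod p) = 0 := by
      rw [ZMod.natCast_eq_zero_iff]; exact_mod_cast he
    have hy : (yNum Q : ZMod p) ≠ 0 := by
      rw [Ne, ZMod.intCast_zmod_eq_zero_iff_dvd]
      exact fun h' ↦ (Nat.prime_iff_prime_int.1 hp).not_isUnit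
        ((isCoprime_yNum_xDen hQ).isUnit_of_dvd' h' he)
    rw [Projective.nonsingular_of_Z_eq_zero (by simp [he']),
      Projective.equation_of_Z_eq_zero (by simp [he'])]
    simp [he', hy]
  · constructor
    · rintro ⟨v, hv, hns⟩
      rw [isPrimitiveRep_iff hQ] at hv
      obtain ⟨⟨j, hj⟩, h2, h₀, h₁⟩ := hv
      have heu : IsUnit (xDen Q : ℤ_[p]) := by
        simpa using (isUnit_intCast_padicInt_iff _).2 he
      refine (nonsingular_toZMod_iff hQ he ?_ h₀ h₁).1 hns
      have h2' (w : ℤ_[p]) (n : ℕ) (c : ℤ_[p]) (h : w * xDen Q ^ n = c * v 2) (hw : IsUnit w) :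
          IsUnit (v 2) := isUnit_of_mul_isUnit_right (h ▸ hw.mul (heu.pow n))
      fin_cases j
      · exact h2' _ _ _ h₀ hj
      · exact h2' _ _ _ h₁ hj
      · exact hj
    · intro hgood
      obtain ⟨-, -, h₀, h₁⟩ := (isPrimitiveRep_iff hQ _).1 hrep
      exact ⟨_, hrep, (nonsingular_toZMod_iff hQ he
        (by simpa using ((isUnit_intCast_padicInt_iff _).2 he).pow 3) h₀ h₁).2 hgood⟩

/-- For a representative close to `O` the middle coordinate is a unit. Eliminating `v 2` from the
two proportionality relations shows that the denominator divides `v 0 * yNum Q` with a unit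
cofactor. For `i = 0` the left side would be nonsingular reduction instead. -/
lemma mem_padicFiltration_iff (hQ : Q ≠ 0) {i : ℕ} (hi : 1 ≤ i) :
    toPadicPoint W p Q ∈ padicFiltration W p i ↔ (p : ℤ) ^ i ∣ xDen Q := by
  have hp : p.Prime := Fact.out
  have hp' : ¬ IsUnit (p : ℤ_[p]) := PadicInt.p_nonunit
  have hpi : (p : ℤ_[p]) ∣ (p : ℤ_[p]) ^ i := dvd_pow_self _ (by omega)
  have hpi' : (p : ℤ) ∣ (p : ℤ) ^ i := dvd_pow_self _ (by omega)
  have hcast : (p : ℤ_[p]) ^ i ∣ (xDen Q : ℤ_[p]) ↔ (p : ℤ) ^ i ∣ xDen Q := by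
    simpa using PadicInt.pow_p_dvd_int_iff i (xDen Q : ℤ) (p := p)
  constructor
  · rintro ⟨-, v, hv, d₀, d₂⟩
    rw [isPrimitiveRep_iff hQ] at hv
    obtain ⟨⟨j, hj⟩, h2, h₀, h₁⟩ := hv
    have hnu {w : ℤ_[p]} (h : (p : ℤ_[p]) ^ i ∣ w) : ¬ IsUnit w := fun hu ↦
      hp' (isUnit_of_dvd_unit (hpi.trans h) hu)
    have hv1 : IsUnit (v 1) := by
      fin_cases j
      · exact (hnu d₀ hj).elim
      · exact hj
      · exact (hnu d₂ hj).elim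
    have he : (p : ℤ) ∣ xDen Q := by
      by_contra he
      have heu : IsUnit (xDen Q : ℤ_[p]) := by
        simpa using (isUnit_intCast_padicInt_iff _).2 he
      exact hnu d₂ (isUnit_of_mul_isUnit_right (h₁ ▸ hv1.mul (heu.pow 3)))
    have hau : IsUnit (xNum Q : ℤ_[p]) := (isUnit_intCast_padicInt_iff _).2 (not_dvd_xNum hp he)
    have he0 : (xDen Q : ℤ_[p]) ^ 2 ≠ 0 := by
      have := (xDen_pos hQ).ne'
      exact_mod_cast pow_ne_zero 2 this
    have key : v 0 * yNum Q = (xNum Q * v 1) * xDen Q :=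
      mul_right_cancel₀ he0 (by linear_combination (yNum Q : ℤ_[p]) * h₀ - (xNum Q : ℤ_[p]) * h₁)
    rw [← hcast, ← (hau.mul hv1).dvd_mul_left, ← key]
    exact d₀.mul_right _
  · intro h
    refine ⟨(mem_nonsingularReduction_iff hQ).2 (isGoodAt_of_dvd_xDen hp (hpi'.trans h)), _,
      exists_isPrimitiveRep hQ, ?_, ?_⟩
    · simpa using (hcast.2 h).mul_left _
    · simpa using dvd_pow (hcast.2 h) three_ne_zero

end WeierstrassCurve

/-! ### Division polynomials as an elliptic sequence -/

namespace WeierstrassCurve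

open Polynomial

section Symmetric

variable {R : Type*} [CommRing R] (W : WeierstrassCurve R)

/-- The polynomial in `t` with roots `x(P + Q)` and `x(P - Q)`, where `a = x(P)` and `b = x(Q)`;
it is symmetric in the three variables. -/
def addSubForm (a b t : R) : R :=
  addSubDen a 1 b 1 * t ^ 2 - W.addSubSum a 1 b 1 * t + W.addSubProd a 1 b 1

lemma addSubForm_comm (a b t : R) : W.addSubForm a b t = W.addSubForm b a t := by
  simp only [addSubForm, addSubDen, addSubSum, addSubProd]; ring

lemma addSubForm_rotate (a b t : R) : W.addSubForm a b t = W.addSubForm b t a := by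
  simp only [addSubForm, addSubDen, addSubSum, addSubProd]; ring

lemma addSubForm_self (a t : R) : W.addSubForm a a t = W.dblNum a 1 - W.dblDen a 1 * t := by
  simp only [addSubForm, addSubDen, addSubSum_self, addSubProd_self]; ring

end Symmetric

section DivisionPolynomial

variable {R : Type*} [CommRing R] (W : WeierstrassCurve R)

lemma eval_Ψ₃_eq (x : R) : W.Ψ₃.eval x = W.dblDen x 1 * x - W.dblNum x 1 := by
  simp only [dblDen, dblNum, Ψ₃]
  simp
  ring

/-- For `x = x(P)` with `P` of infinite order, the right side is `Ψ₃² (x - x(3P))`, the quantity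
that enters the recursion for the fourth term of `xSeq`. -/
lemma eval_preΨ₄_mul_dblDen (x : R) : W.preΨ₄.eval x * W.dblDen x 1 =
    2 * x * W.Ψ₃.eval x ^ 2 - W.addSubSum (W.dblNum x 1) (W.dblDen x 1) x 1 := by
  have b := W.b_relation
  simp only [dblDen, dblNum, Ψ₃, preΨ₄, addSubSum]
  simp
  grind

end DivisionPolynomial

namespace Affine.Point

variable {F : Type*} [Field F] [DecidableEq F] {W : Affine F}

lemma xRep_one_of_ne_zero {K : Type*} [Field K] {W : Affine K} {Q : W.Point} (hQ : Q ≠ 0) : Q.xRep 1 = 1 := by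
  rcases Q with _ | _
  · exact (hQ rfl).elim
  · simp

lemma addSubForm_eq {P Q : W.Point} (hP : P ≠ 0) (hQ : Q ≠ 0) (hs : P + Q ≠ 0) (hd : P - Q ≠ 0)
    (t : F) : addSubForm W (P.xRep 0) (Q.xRep 0) t =
      (P.xRep 0 - Q.xRep 0) ^ 2 * (((P + Q).xRep 0 - t) * ((P - Q).xRep 0 - t)) := by
  obtain ⟨c, h₀, h₁, h₂⟩ := exists_addSub P Q
  rw [xRep_one_of_ne_zero hP, xRep_one_of_ne_zero hQ, xRep_one_of_ne_zero hs,
    xRep_one_of_ne_zero hd] at *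
  have hc : c = (P.xRep 0 - Q.xRep 0) ^ 2 := by
    rw [addSubDen] at h₀; linear_combination -h₀
  rw [addSubForm, h₀, h₁, h₂, ← hc]
  ring

lemma dblNum_eq {P : W.Point} (hP : P ≠ 0) (hs : P + P ≠ 0) :
    dblNum W (P.xRep 0) 1 = dblDen W (P.xRep 0) 1 * (P + P).xRep 0 := by
  obtain ⟨c, -, h₁, h₂⟩ := exists_addSub P P
  rw [xRep_one_of_ne_zero hP, xRep_one_of_ne_zero hs, sub_self, xRep_zero] at *
  rw [addSubSum_self] at h₁
  rw [addSubProd_self] at h₂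
  rw [h₁, h₂]
  simp

end Affine.Point

section Sequence

variable {F : Type*} [Field F] [DecidableEq F] {W : Affine F} {x y : F} (h : W.Nonsingular x y)

/-- The `x`-coordinates of the multiples of an affine point. -/
noncomputable def mulX (n : ℤ) : F := (n • Affine.Point.some x y h).xRep 0

/-- The elliptic sequence defined by the `x`-coordinates of the multiples of a point. -/
noncomputable def xSeq : ℕ → F
  | 0 => 0
  | 1 => 1
  | 2 => W.ψ₂.evalEval x y
  -- The case `m = 1` of `ψ_{n+m} ψ_{n-m} = (x_m - x_n) ψ_n² ψ_m²`, solved for the top term.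
  | n + 3 => xSeq (n + 2) ^ 2 * (x - mulX h (n + 2 : ℕ)) / xSeq (n + 1)

lemma mulX_neg (n : ℤ) : mulX h (-n) = mulX h n := by
  rw [mulX, neg_smul, Affine.Point.xRep_neg, mulX]

lemma mulX_one : mulX h 1 = x := by simp [mulX]

lemma evalEval_ψ₂_sq {K : Type*} [Field K] {W : Affine K} {x y : K} (h : W.Nonsingular x y) :
    W.ψ₂.evalEval x y ^ 2 = W.dblDen x 1 := by
  have he := h.1
  rw [Affine.equation_iff] at he
  rw [ψ₂, Affine.evalEval_polynomialY]
  simp only [dblDen, b₂, b₄, b₆]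
  linear_combination 4 * he

lemma mulX_ne (hP : ∀ n : ℤ, n ≠ 0 → n • Affine.Point.some x y h ≠ 0)
    {n m : ℤ} (hn : n ≠ 0) (hm : m ≠ 0) (h₁ : n + m ≠ 0) (h₂ : n - m ≠ 0) :
    mulX h n ≠ mulX h m := by
  intro heq
  have : (n • Affine.Point.some x y h).xRep = (m • Affine.Point.some x y h).xRep := by
    ext i
    fin_cases i
    · exact heq
    · simp [Affine.Point.xRep_one_of_ne_zero (hP _ hn), Affine.Point.xRep_one_of_ne_zero (hP _ hm)]
  rcases Affine.Point.eq_or_eq_neg_of_xRep_eq_xRep this with h | h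
  · exact hP _ h₂ (by rw [sub_smul, h, sub_self])
  · exact hP _ h₁ (by rw [add_smul, h, neg_add_cancel])

lemma addSubForm_mulX (hP : ∀ n : ℤ, n ≠ 0 → n • Affine.Point.some x y h ≠ 0)
    {n m : ℤ} (hn : n ≠ 0) (hm : m ≠ 0) (h₁ : n + m ≠ 0) (h₂ : n - m ≠ 0)
    (t : F) : addSubForm W (mulX h n) (mulX h m) t =
      (mulX h n - mulX h m) ^ 2 * ((mulX h (n + m) - t) * (mulX h (n - m) - t)) := by
  have := Affine.Point.addSubForm_eq (hP n hn) (hP m hm) (by rw [← add_smul]; exact hP _ h₁)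
    (by rw [← sub_smul]; exact hP _ h₂) t
  rwa [← add_smul, ← sub_smul] at this

lemma dblNum_mulX (hP : ∀ n : ℤ, n ≠ 0 → n • Affine.Point.some x y h ≠ 0)
    : W.dblNum x 1 = W.dblDen x 1 * mulX h 2 := by
  have := Affine.Point.dblNum_eq (P := .some x y h) (Affine.Point.some_ne_zero h)
    (by rw [← two_zsmul]; exact hP 2 two_ne_zero)
  rwa [← two_zsmul] at this

lemma xSeq_ne_zero (hP : ∀ n : ℤ, n ≠ 0 → n • Affine.Point.some x y h ≠ 0)
    (n : ℕ) : xSeq h (n + 1) ≠ 0 := by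
  induction n using Nat.strong_induction_on with
  | _ n ih =>
    match n with
    | 0 => simp [xSeq]
    | 1 =>
      intro h0
      have h0 : W.ψ₂.evalEval x y = 0 := h0
      have hne := hP 2 two_ne_zero
      apply hne
      rw [two_zsmul]
      refine Affine.Point.add_self_of_Y_eq ?_
      rw [ψ₂, Affine.evalEval_polynomialY] at h0
      rw [Affine.negY]
      linear_combination h0
    | n + 2 =>
      rw [xSeq]
      have hx := mulX_ne h hP (n := 1) (m := (n + 2 : ℕ)) one_ne_zero (by omega) (by omega) (by omega)
      rw [mulX_one] at hx
      exact div_ne_zero (mul_ne_zero (pow_ne_zero _ (ih (n + 1) (by omega))) (sub_ne_zero.2 hx))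
        (ih n (by omega))

lemma xSeq_step (hP : ∀ n : ℤ, n ≠ 0 → n • Affine.Point.some x y h ≠ 0)
    {n : ℕ} (hn : 1 ≤ n) :
    xSeq h (n + 1 + 1) * xSeq h n = (x - mulX h (n + 1 : ℕ)) * xSeq h (n + 1) ^ 2 := by
  obtain ⟨k, rfl⟩ : ∃ k, n = k + 1 := ⟨n - 1, by omega⟩
  rw [xSeq]
  field_simp [xSeq_ne_zero h hP k]

/-- Let `T(n, m)` be the relation with `n = k + m`; the variable `k` avoids subtraction. The left
sides of `T(n+1, m) T(n-1, m)` and `T(n, m+1) T(n, m-1)` have the same product, and the right sides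
agree because `addSubForm` is symmetric in `x_n`, `x_1`, `x_m`. So `T(n, m+1)` follows by cancelling
nonzero terms. -/
lemma xSeq_add_mul_xSeq_sub (hP : ∀ n : ℤ, n ≠ 0 → n • Affine.Point.some x y h ≠ 0)
    (m : ℕ) : ∀ k : ℕ, 1 ≤ k → 1 ≤ m →
    xSeq h (k + m + m) * xSeq h k =
      (mulX h m - mulX h (k + m : ℕ)) * xSeq h (k + m) ^ 2 * xSeq h m ^ 2 := by
  have hne {n : ℕ} (hn : 1 ≤ n) : xSeq h n ≠ 0 := by
    obtain ⟨k, rfl⟩ : ∃ k, n = k + 1 := ⟨n - 1, by omega⟩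
    exact xSeq_ne_zero h hP k
  induction m using Nat.strong_induction_on with
  | _ m ih =>
    intro k hk hm
    match m, hm with
    | 1, _ =>
      rw [xSeq_step h hP hk]
      simp [xSeq, mulX_one]
    | 2, _ =>
      have s₁ := xSeq_step h hP (n := k + 2) (by omega)
      have s₂ := xSeq_step h hP (n := k + 1) (by omega)
      have s₃ := xSeq_step h hP (n := k) (by omega)
      have f₁ := addSubForm_mulX h hP (n := (k + 2 : ℕ)) (m := 1) (by omega) one_ne_zero (by omega)
        (by omega) x
      rw [mulX_one, addSubForm_rotate, addSubForm_self, dblNum_mulX h hP,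
        show ((k + 2 : ℕ) : ℤ) + 1 = (k + 2 + 1 : ℕ) by push_cast; ring,
        show ((k + 2 : ℕ) : ℤ) - 1 = (k + 1 : ℕ) by push_cast; ring, ← evalEval_ψ₂_sq h] at f₁
      have e₂ : xSeq h 2 = W.ψ₂.evalEval x y := rfl
      rw [← e₂] at f₁
      have h₀ := hne (n := k + 2) (by omega)
      refine mul_right_cancel₀ (pow_ne_zero 2 h₀) ?_
      generalize mulX h (k + 2 + 1 : ℕ) = x₃ at *
      generalize mulX h (k + 2 : ℕ) = x₂ at *
      generalize mulX h (k + 1 : ℕ) = x₁ at *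
      push_cast at *
      simp only [Nat.add_assoc, Nat.reduceAdd] at *
      linear_combination (xSeq h (k + 2) * xSeq h k) * s₁ +
        (x - x₃) * xSeq h (k + 3) ^ 2 * s₃ + (x - x₃) * (x - x₁) * (xSeq h (k + 3) * xSeq h (k + 1) +
        (x - x₂) * xSeq h (k + 2) ^ 2) * s₂ - xSeq h (k + 2) ^ 4 * f₁
    | m + 3, _ =>
      have t₁ := ih (m + 2) (by omega) (k + 2) (by omega) (by omega)
      have t₂ := ih (m + 2) (by omega) k hk (by omega)
      have t₃ := ih (m + 1) (by omega) (k + 2) (by omega) (by omega)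
      have s₁ := xSeq_step h hP (n := k + m + 2) (by omega)
      have s₂ := xSeq_step h hP (n := m + 1) (by omega)
      have f₁ := addSubForm_mulX h hP (n := (k + m + 3 : ℕ)) (m := 1) (by omega) one_ne_zero
        (by omega) (by omega) (mulX h (m + 2 : ℕ))
      have f₂ := addSubForm_mulX h hP (n := (m + 2 : ℕ)) (m := 1) (by omega) one_ne_zero
        (by omega) (by omega) (mulX h (k + m + 3 : ℕ))
      rw [addSubForm_rotate, addSubForm_comm, f₂] at f₁
      rw [show ((k + m + 3 : ℕ) : ℤ) + 1 = (k + m + 4 : ℕ) by push_cast; ring,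
        show ((k + m + 3 : ℕ) : ℤ) - 1 = (k + m + 2 : ℕ) by push_cast; ring,
        show ((m + 2 : ℕ) : ℤ) + 1 = (m + 3 : ℕ) by push_cast; ring,
        show ((m + 2 : ℕ) : ℤ) - 1 = (m + 1 : ℕ) by push_cast; ring, mulX_one] at f₁
      rw [show k + 2 + (m + 2) + (m + 2) = k + m + m + 6 by ring,
        show k + 2 + (m + 2) = k + m + 4 by ring] at t₁
      rw [show k + (m + 2) + (m + 2) = k + m + m + 4 by ring,
        show k + (m + 2) = k + m + 2 by ring] at t₂
      rw [show k + 2 + (m + 1) + (m + 1) = k + m + m + 4 by ring,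
        show k + 2 + (m + 1) = k + m + 3 by ring] at t₃
      rw [show k + (m + 3) + (m + 3) = k + m + m + 6 by ring,
        show k + (m + 3) = k + m + 3 by ring]
      simp only [Nat.add_assoc, Nat.reduceAdd] at *
      have h₁ := hne (n := k + (m + (m + 4))) (by omega)
      have h₂ := hne (n := k + 2) (by omega)
      refine mul_right_cancel₀ (mul_ne_zero h₁ h₂) ?_
      generalize mulX h (k + (m + 4) : ℕ) = x₁ at *
      generalize mulX h (k + (m + 3) : ℕ) = x₂ at *
      generalize mulX h (k + (m + 2) : ℕ) = x₃ at *
      generalize mulX h (m + 3 : ℕ) = x₄ at *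
      generalize mulX h (m + 2 : ℕ) = x₅ at *
      generalize mulX h (m + 1 : ℕ) = x₆ at *
      generalize xSeq h (k + (m + (m + 6))) = v₁ at *
      generalize xSeq h (k + (m + (m + 4))) = v₂ at *
      generalize xSeq h (k + 2) = v₃ at *
      generalize xSeq h (k + (m + 4)) = v₄ at *
      generalize xSeq h (k + (m + 3)) = v₅ at *
      generalize xSeq h (k + (m + 2)) = v₆ at *
      generalize xSeq h (m + 3) = v₇ at *
      generalize xSeq h (m + 2) = v₈ at *
      generalize xSeq h (m + 1) = v₉ at *
      generalize xSeq h k = v₀ at *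
      linear_combination (v₂ * v₀) * t₁ + (x₅ - x₁) * v₄ ^ 2 * v₈ ^ 2 * t₂ -
        (x₄ - x₂) * v₅ ^ 2 * v₇ ^ 2 * t₃ +
        (x₅ - x₁) * (x₅ - x₃) * v₈ ^ 4 * (v₄ * v₆ + (x - x₂) * v₅ ^ 2) * s₁ -
        (x₄ - x₂) * (x₆ - x₂) * v₅ ^ 4 * (v₇ * v₉ + (x - x₅) * v₈ ^ 2) * s₂ - v₅ ^ 4 * v₈ ^ 4 * f₁

lemma xSeq_add_mul_xSeq_sub' (hP : ∀ n : ℤ, n ≠ 0 → n • Affine.Point.some x y h ≠ 0) {n m : ℕ}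
    (hm : 1 ≤ m) (hmn : m < n) : xSeq h (n + m) * xSeq h (n - m) =
      (mulX h m - mulX h n) * xSeq h n ^ 2 * xSeq h m ^ 2 := by
  have := xSeq_add_mul_xSeq_sub h hP m (n - m) (by omega) hm
  rwa [Nat.sub_add_cancel hmn.le] at this

lemma xSeq_three (hP : ∀ n : ℤ, n ≠ 0 → n • Affine.Point.some x y h ≠ 0) :
    xSeq h 3 = W.Ψ₃.eval x := by
  have := xSeq_step h hP (n := 1) le_rfl
  norm_num at this
  rw [eval_Ψ₃_eq, dblNum_mulX h hP, ← evalEval_ψ₂_sq h]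
  have e₁ : xSeq h 1 = 1 := rfl
  have e₂ : xSeq h 2 = W.ψ₂.evalEval x y := rfl
  rw [e₁, e₂] at this
  linear_combination this

lemma xSeq_four (hP : ∀ n : ℤ, n ≠ 0 → n • Affine.Point.some x y h ≠ 0) :
    xSeq h 4 = W.preΨ₄.eval x * W.ψ₂.evalEval x y := by
  have e₂ : xSeq h 2 = W.ψ₂.evalEval x y := rfl
  have hne : xSeq h 2 ≠ 0 := xSeq_ne_zero h hP 1
  have e₃ := xSeq_three h hP
  have s := xSeq_step h hP (n := 2) (by norm_num)
  have s' := xSeq_step h hP (n := 1) (by norm_num)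
  norm_num at s s'
  have e₁ : xSeq h 1 = 1 := rfl
  have f (t : F) := addSubForm_mulX h hP (n := 2) (m := 1) two_ne_zero one_ne_zero
    (by norm_num) (by norm_num) t
  norm_num at f
  -- The values at `t = 0` and `t = 1` isolate the coefficient of `t`, that is `x(3P) + x(P)`.
  have f₀ := f 0
  have f₁ := f 1
  have d := dblNum_mulX h hP
  have q := evalEval_ψ₂_sq h
  rw [mulX_one] at f₀ f₁
  simp only [addSubForm, addSubDen] at f₀ f₁
  rw [← e₂] at q ⊢
  have hS : W.addSubSum (W.dblNum x 1) (W.dblDen x 1) x 1 =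
      W.dblDen x 1 ^ 2 * W.addSubSum (mulX h 2) 1 x 1 := by
    rw [d]; simp only [addSubSum]; ring
  have hS' : W.addSubSum (mulX h 2) 1 x 1 = (mulX h 2 - x) ^ 2 * (mulX h 3 + x) := by
    linear_combination f₀ - f₁
  have hψ := W.eval_preΨ₄_mul_dblDen x
  have h₃ := W.eval_Ψ₃_eq x
  refine mul_right_cancel₀ hne ?_
  rw [s, mul_assoc, ← pow_two, q, hψ, hS, hS', e₃, h₃, d]
  ring

end Sequence

end WeierstrassCurve

namespace WeierstrassCurve

open Polynomial

section Sequence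

variable {F : Type*} [Field F] [DecidableEq F] {W : Affine F} {x y : F} (h : W.Nonsingular x y)

/-- Both sequences have the same first five values and obey the same duplication recursions. For
`xSeq` these are the relations with index difference `2` or `1`, after writing `x_m - x_n` as `(x -
x_n) - (x - x_m)`. -/
lemma evalEval_ψ_natCast (hP : ∀ n : ℤ, n ≠ 0 → n • Affine.Point.some x y h ≠ 0) (n : ℕ) :
    (WeierstrassCurve.ψ W n).evalEval x y = xSeq h n := by
  have hne {n : ℕ} (hn : 1 ≤ n) : xSeq h n ≠ 0 := by
    obtain ⟨k, rfl⟩ : ∃ k, n = k + 1 := ⟨n - 1, by omega⟩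
    exact xSeq_ne_zero h hP k
  induction n using normEDSRec with
  | zero => simp [xSeq]
  | one => simp [xSeq]
  | two => simp [xSeq]
  | three => simp [xSeq_three h hP, evalEval_C]
  | four => simp [xSeq_four h hP, evalEval_C, evalEval_mul]
  | even m i₁ i₂ i₃ i₄ i₅ =>
    have key := congrArg (evalEval x y) (WeierstrassCurve.ψ_even W (m + 3))
    simp only [evalEval_mul, evalEval_sub, evalEval_pow] at key
    rw [show (m + 3 - 1 : ℤ) = (m + 2 : ℕ) by push_cast; ring,
      show (m + 3 - 2 : ℤ) = (m + 1 : ℕ) by push_cast; ring,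
      show (m + 3 + 1 : ℤ) = (m + 4 : ℕ) by push_cast; ring,
      show (m + 3 + 2 : ℤ) = (m + 5 : ℕ) by push_cast; ring,
      show (m + 3 : ℤ) = (m + 3 : ℕ) by push_cast; ring, i₁, i₂, i₃, i₄, i₅] at key
    have e₂ : xSeq h 2 = W.ψ₂.evalEval x y := rfl
    have s := xSeq_add_mul_xSeq_sub' h hP (n := m + 4) (m := m + 2) (by omega) (by omega)
    rw [show m + 4 + (m + 2) = 2 * (m + 3) by ring, show m + 4 - (m + 2) = 2 by omega] at s
    have s₁ := xSeq_step h hP (n := m + 3) (by omega)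
    have s₂ := xSeq_step h hP (n := m + 1) (by omega)
    have h₂ : xSeq h 2 ≠ 0 := hne (by norm_num)
    rw [← e₂] at key
    push_cast at *
    refine mul_right_cancel₀ h₂ (key.trans ?_)
    simp only [Nat.add_assoc, Nat.reduceAdd] at s₁ s₂
    norm_num [add_assoc] at s₁ s₂
    linear_combination xSeq h (m + 2) ^ 2 * s₁ - xSeq h (m + 4) ^ 2 * s₂ - s
  | odd m i₁ i₂ i₃ i₄ =>
    have key := congrArg (evalEval x y) (WeierstrassCurve.ψ_odd W (m + 2))
    simp only [evalEval_mul, evalEval_sub, evalEval_pow] at key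
    rw [show (m + 2 - 1 : ℤ) = (m + 1 : ℕ) by push_cast; ring,
      show (m + 2 + 1 : ℤ) = (m + 3 : ℕ) by push_cast; ring,
      show (m + 2 + 2 : ℤ) = (m + 4 : ℕ) by push_cast; ring,
      show (m + 2 : ℤ) = (m + 2 : ℕ) by push_cast; ring, i₁, i₂, i₃, i₄] at key
    have s := xSeq_add_mul_xSeq_sub' h hP (n := m + 3) (m := m + 2) (by omega) (by omega)
    rw [show m + 3 + (m + 2) = 2 * (m + 2) + 1 by ring, show m + 3 - (m + 2) = 1 by omega] at s
    have s₁ := xSeq_step h hP (n := m + 2) (by omega)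
    have s₂ := xSeq_step h hP (n := m + 1) (by omega)
    have e₁ : xSeq h 1 = 1 := rfl
    rw [e₁] at s
    push_cast at *
    refine key.trans ?_
    simp only [Nat.add_assoc, Nat.reduceAdd] at s₁ s₂
    norm_num [add_assoc] at s₁ s₂
    linear_combination xSeq h (m + 2) ^ 2 * s₁ - xSeq h (m + 3) ^ 2 * s₂ - s

/-- The division polynomials of a point of infinite order are an elliptic sequence describing the
differences of the `x`-coordinates of its multiples. -/
lemma evalEval_ψ_add_mul_sub (hP : ∀ n : ℤ, n ≠ 0 → n • Affine.Point.some x y h ≠ 0) {n m : ℤ}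
    (hn : n ≠ 0) (hm : m ≠ 0) :
    (WeierstrassCurve.ψ W (n + m)).evalEval x y * (WeierstrassCurve.ψ W (n - m)).evalEval x y =
      (mulX h m - mulX h n) * (WeierstrassCurve.ψ W n).evalEval x y ^ 2 *
        (WeierstrassCurve.ψ W m).evalEval x y ^ 2 := by
  have hneg (n : ℤ) : (WeierstrassCurve.ψ W (-n)).evalEval x y =
      -(WeierstrassCurve.ψ W n).evalEval x y := by
    rw [ψ_neg, evalEval_neg]
  have hneg' (n m : ℤ) : (WeierstrassCurve.ψ W (n - m)).evalEval x y =
      -(WeierstrassCurve.ψ W (m - n)).evalEval x y := by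
    rw [← hneg, neg_sub]
  have pos (n m : ℕ) (hm : 1 ≤ m) (hmn : m < n) :
      (WeierstrassCurve.ψ W (n + m)).evalEval x y * (WeierstrassCurve.ψ W (n - m)).evalEval x y =
      (mulX h m - mulX h n) * (WeierstrassCurve.ψ W n).evalEval x y ^ 2 *
        (WeierstrassCurve.ψ W m).evalEval x y ^ 2 := by
    rw [← Nat.cast_add, ← Nat.cast_sub hmn.le]
    simp only [evalEval_ψ_natCast h hP]
    exact xSeq_add_mul_xSeq_sub' h hP hm hmn
  have nat (n m : ℕ) (hn : 1 ≤ n) (hm : 1 ≤ m) :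
      (WeierstrassCurve.ψ W (n + m)).evalEval x y * (WeierstrassCurve.ψ W (n - m)).evalEval x y =
      (mulX h m - mulX h n) * (WeierstrassCurve.ψ W n).evalEval x y ^ 2 *
        (WeierstrassCurve.ψ W m).evalEval x y ^ 2 := by
    rcases lt_trichotomy m n with hlt | rfl | hlt
    · exact pos n m hm hlt
    · simp
    · have := pos m n hn hlt
      rw [hneg' n m, add_comm]
      linear_combination -this
  obtain ⟨a, rfl | rfl⟩ := n.eq_nat_or_neg <;> obtain ⟨b, rfl | rfl⟩ := m.eq_nat_or_neg
  · exact nat a b (by omega) (by omega)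
  · rw [mulX_neg, hneg b, ← sub_eq_add_neg, sub_neg_eq_add]
    linear_combination nat a b (by omega) (by omega)
  · rw [mulX_neg, hneg a, neg_add_eq_sub, hneg', ← neg_add', hneg]
    linear_combination nat a b (by omega) (by omega)
  · rw [mulX_neg, mulX_neg, hneg a, hneg b, ← neg_add, hneg, neg_sub_neg, hneg']
    linear_combination nat a b (by omega) (by omega)

end Sequence

variable {W : WeierstrassCurve ℤ} {P : (W.baseChange ℚ).toAffine.Point}

lemma zsmul_ne_zero_of_not_isOfFinAddOrder {A : Type*} [AddGroup A] {P : A}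
    (hP : ¬ IsOfFinAddOrder P) {n : ℤ} (hn : n ≠ 0) : n • P ≠ 0 := fun h ↦
  hP (isOfFinAddOrder_iff_zsmul_eq_zero.2 ⟨n, hn, h⟩)

lemma xNum_div_xDen {Q : (W.baseChange ℚ).toAffine.Point} (hQ : Q ≠ 0) :
    Q.xRep 0 = xNum Q / (xDen Q : ℚ) ^ 2 := by
  have hpos := xDen_pos hQ
  obtain ⟨t, ht, h₁, h₂⟩ := exists_xRep_scale Q
  rw [h₁, h₂, Affine.Point.xRep_one_of_ne_zero hQ]
  field_simp

lemma psiAt_neg (n : ℤ) : psiAt W (-n) P = -psiAt W n P := by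
  cases P <;> simp [psiAt]

lemma psiAt_ne_zero (hP : ¬ IsOfFinAddOrder P) {n : ℤ} (hn : n ≠ 0) : psiAt W n P ≠ 0 := by
  rcases P with _ | ⟨x, y, h⟩
  · exact (hP (by rw [← Affine.Point.zero_def]; exact IsOfFinAddOrder.zero)).elim
  have h' : ∀ n : ℤ, n ≠ 0 → n • Affine.Point.some x y h ≠ 0 := fun n hn ↦
    zsmul_ne_zero_of_not_isOfFinAddOrder hP hn
  have key (m : ℕ) (hm : m ≠ 0) : psiAt W m (.some x y h) ≠ 0 := by
    rw [psiAt, evalEval_ψ_natCast h h']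
    obtain ⟨k, rfl⟩ := Nat.exists_eq_succ_of_ne_zero hm
    exact xSeq_ne_zero h h' k
  obtain ⟨m, rfl | rfl⟩ := n.eq_nat_or_neg
  · exact key m (by omega)
  · rw [psiAt_neg, neg_ne_zero]
    exact key m (by omega)

/-- The two sides differ by a positive rational factor. Only the sign of `ψ_n(P)` is needed: its
size may differ from the denominator at primes of bad reduction. -/
lemma sign_psiAt_mul (hP : ¬ IsOfFinAddOrder P) {n m : ℤ} (hn : n ≠ 0) (hm : m ≠ 0) :
    SignType.sign (psiAt W (n + m) P * psiAt W (n - m) P) =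
      SignType.sign (xNum (m • P) * (xDen (n • P) : ℤ) ^ 2 -
        xNum (n • P) * (xDen (m • P) : ℤ) ^ 2) := by
  have key : ∃ c : ℚ, 0 < c ∧ psiAt W (n + m) P * psiAt W (n - m) P =
      c * ((xNum (m • P) * (xDen (n • P) : ℤ) ^ 2 - xNum (n • P) * (xDen (m • P) : ℤ) ^ 2 : ℤ) : ℚ) := by
    have w₁ := psiAt_ne_zero hP hn
    have w₂ := psiAt_ne_zero hP hm
    have n₁ := zsmul_ne_zero_of_not_isOfFinAddOrder hP hn
    have n₂ := zsmul_ne_zero_of_not_isOfFinAddOrder hP hm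
    have d₁ := xDen_pos n₁
    have d₂ := xDen_pos n₂
    have x₁ := xNum_div_xDen n₁
    have x₂ := xNum_div_xDen n₂
    rcases P with _ | ⟨x, y, h⟩
    · exact (hP (by rw [← Affine.Point.zero_def]; exact IsOfFinAddOrder.zero)).elim
    have := evalEval_ψ_add_mul_sub h (fun n hn ↦ zsmul_ne_zero_of_not_isOfFinAddOrder hP hn) hn hm
    rw [mulX, mulX, x₁, x₂] at this
    change psiAt W (n + m) (.some x y h) * psiAt W (n - m) (.some x y h) =
      _ * psiAt W n (.some x y h) ^ 2 * psiAt W m (.some x y h) ^ 2 at this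
    refine ⟨psiAt W n (.some x y h) ^ 2 * psiAt W m (.some x y h) ^ 2 /
      ((xDen (n • Affine.Point.some x y h) : ℚ) ^ 2 * (xDen (m • Affine.Point.some x y h) : ℚ) ^ 2),
      by positivity, this.trans ?_⟩
    push_cast
    field_simp
  obtain ⟨c, hc, h⟩ := key
  rw [h, sign_mul, sign_pos hc, one_mul]
  generalize (xNum (m • P) * (xDen (n • P) : ℤ) ^ 2 - xNum (n • P) * (xDen (m • P) : ℤ) ^ 2) = k
  simp only [sign_apply, Int.cast_pos, Int.cast_lt_zero]

end WeierstrassCurve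

/-! ### Sequences with constant second quotient modulo prime powers -/

/-- A sequence in a commutative group with constant second quotient. -/
lemma eq_mul_pow_mul_pow_choose_two {G : Type*} [CommGroup G] {b : ℕ → G} {a : G}
    (h : ∀ t, b (t + 2) * b t = a * b (t + 1) ^ 2) (t : ℕ) :
    b t = b 0 * (b 1 / b 0) ^ t * a ^ t.choose 2 := by
  have step (t : ℕ) : b (t + 1) = b t * (b 1 / b 0) * a ^ t := by
    induction t with
    | zero => simp
    | succ t ih =>
      have h₁ : b (t + 2) = a * b (t + 1) ^ 2 / b t := eq_div_of_mul_eq' (h t)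
      rw [h₁, pow_succ a]
      have h₂ : b (t + 1) / b t = b 1 / b 0 * a ^ t := by
        rw [ih, mul_assoc, mul_div_cancel_left]
      calc a * b (t + 1) ^ 2 / b t = a * b (t + 1) * (b (t + 1) / b t) := by
            rw [pow_two, mul_div_assoc', mul_assoc]
        _ = _ := by rw [h₂]; simp only [mul_comm, mul_left_comm, mul_assoc]
  induction t with
  | zero => simp
  | succ t ih =>
    rw [step, ih, Nat.choose_succ_succ' t 1, Nat.choose_one_right, pow_succ (b 1 / b 0) t, pow_add]
    simp only [Nat.reduceAdd, mul_comm, mul_left_comm, mul_assoc]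

/-- The arithmetic core of periodicity: the terms `β (n + t r)` share one truncated valuation `j`,
and their unit parts modulo `p^(k-j)` follow the explicit formula for constant second quotient. -/
lemma dvd_sub_of_mul_sub_sq {p : ℕ} (hp : p.Prime) {k N : ℕ} {A r : ℤ} {β : ℤ → ℤ}
    (hA : ¬ (p : ℤ) ∣ A) (hN : (p ^ k).totient ∣ N) (hAN : (p : ℤ) ^ k ∣ A ^ N.choose 2 - 1)
    (hrec : ∀ n, (p : ℤ) ^ (2 * k) ∣ β (n + r) * β (n - r) - A * β n ^ 2)
    (hval : ∀ n, ∀ j ≤ k, (p : ℤ) ^ j ∣ β n ↔ (p : ℤ) ^ j ∣ β (n + r)) (n : ℤ) :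
    (p : ℤ) ^ k ∣ β (n + N * r) - β n := by
  have hp' := Nat.prime_iff_prime_int.1 hp
  have hval' (j : ℕ) (hj : j ≤ k) (t : ℕ) : (p : ℤ) ^ j ∣ β (n + t * r) ↔ (p : ℤ) ^ j ∣ β n := by
    induction t with
    | zero => simp
    | succ t ih =>
      rw [← ih, hval (n + t * r) j hj]
      push_cast
      rw [add_mul, one_mul, add_assoc]
  by_cases hk : (p : ℤ) ^ k ∣ β n
  · exact dvd_sub ((hval' k le_rfl N).2 hk) hk
  obtain ⟨j, hjk, hj, hj'⟩ : ∃ j < k, (p : ℤ) ^ j ∣ β n ∧ ¬ (p : ℤ) ^ (j + 1) ∣ β n := by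
    by_contra! hc
    have : ∀ j ≤ k, (p : ℤ) ^ j ∣ β n := by
      intro j
      induction j with
      | zero => simp
      | succ j ih => exact fun h ↦ hc j (by omega) (ih (by omega))
    exact hk (this k le_rfl)
  have hex (t : ℕ) : ∃ B, β (n + t * r) = (p : ℤ) ^ j * B := (hval' j hjk.le t).2 hj
  choose B hB using hex
  have hunit (t : ℕ) : ¬ (p : ℤ) ∣ B t := fun ⟨c, hc⟩ ↦
    hj' ((hval' (j + 1) hjk t).1 ⟨c, by rw [hB, hc, pow_succ, mul_assoc]⟩)
  have hp0 : (p : ℤ) ^ (2 * j) ≠ 0 := pow_ne_zero _ (by exact_mod_cast hp.ne_zero)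
  -- Dividing by `p^(2j)` leaves the modulus `p^(2(k-j))`. This is why the recurrence is needed
  -- modulo `p^(2k)`, not merely `p^k`.
  have hstep (t : ℕ) : (p : ℤ) ^ (k - j) ∣ B (t + 2) * B t - A * B (t + 1) ^ 2 := by
    have := hrec (n + (t + 1 : ℕ) * r)
    rw [show n + (t + 1 : ℕ) * r + r = n + (t + 2 : ℕ) * r by push_cast; ring,
      show n + (t + 1 : ℕ) * r - r = n + t * r by push_cast; ring, hB, hB, hB,
      show (p : ℤ) ^ j * B (t + 2) * (p ^ j * B t) - A * (p ^ j * B (t + 1)) ^ 2 =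
        p ^ (2 * j) * (B (t + 2) * B t - A * B (t + 1) ^ 2) by ring,
      show 2 * k = 2 * j + (2 * (k - j)) by omega, pow_add, mul_dvd_mul_iff_left hp0] at this
    exact (pow_dvd_pow _ (by omega)).trans this
  have hcop {z : ℤ} (hz : ¬ (p : ℤ) ∣ z) : IsUnit (z : ZMod (p ^ (k - j))) := by
    rw [ZMod.coe_int_isUnit_iff_isCoprime]
    push_cast
    exact (hp'.coprime_iff_not_dvd.2 hz).pow_left
  set b : ℕ → (ZMod (p ^ (k - j)))ˣ := fun t ↦ (hcop (hunit t)).unit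
  set a : (ZMod (p ^ (k - j)))ˣ := (hcop hA).unit
  have hb : ∀ t, b (t + 2) * b t = a * b (t + 1) ^ 2 := by
    intro t
    ext
    have := (ZMod.intCast_eq_intCast_iff_dvd_sub _ _ (p ^ (k - j))).2
      (by push_cast; exact hstep t)
    push_cast at this
    simpa [a, b] using this.symm
  have hbN := eq_mul_pow_mul_pow_choose_two hb N
  have htot (u : (ZMod (p ^ (k - j)))ˣ) : u ^ N = 1 := by
    obtain ⟨c, hc⟩ := (Nat.totient_dvd_of_dvd (pow_dvd_pow p (Nat.sub_le k j))).trans hN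
    rw [hc, pow_mul, ZMod.pow_totient, one_pow]
  have ha : a ^ N.choose 2 = 1 := by
    ext
    have := (ZMod.intCast_eq_intCast_iff_dvd_sub 1 (A ^ N.choose 2) (p ^ (k - j))).2
      (by push_cast; exact (pow_dvd_pow _ (Nat.sub_le k j)).trans hAN)
    push_cast at this
    simpa [a] using this.symm
  rw [htot, ha, mul_one, mul_one] at hbN
  have hBN : (p : ℤ) ^ (k - j) ∣ B N - B 0 := by
    have := (ZMod.intCast_eq_intCast_iff_dvd_sub (B 0) (B N) (p ^ (k - j))).1
      (congrArg Units.val hbN).symm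
    exact_mod_cast this
  have h₀ := hB 0
  rw [Nat.cast_zero, zero_mul, add_zero] at h₀
  rw [hB, h₀, ← mul_sub, show k = j + (k - j) by omega, pow_add]
  exact mul_dvd_mul_left _ hBN

/-! ### The integer sequence `β_n` and its elliptic relation -/

namespace WeierstrassCurve

variable {W : WeierstrassCurve ℤ} {P : (W.baseChange ℚ).toAffine.Point} {p : ℕ}

lemma pow_dvd_xDen_nsmul (hp : p.Prime) {i : ℕ} (h : (p : ℤ) ^ i ∣ xDen P) (n : ℕ) :
    (p : ℤ) ^ i ∣ xDen (n • P) := by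
  induction n with
  | zero => simp [xDen_zero]
  | succ n ih => rw [succ_nsmul]; exact pow_dvd_xDen_add hp ih h

lemma pow_dvd_xDen_zsmul (hp : p.Prime) {i : ℕ} (h : (p : ℤ) ^ i ∣ xDen P) (n : ℤ) :
    (p : ℤ) ^ i ∣ xDen (n • P) := by
  obtain ⟨n, rfl | rfl⟩ := n.eq_nat_or_neg
  · simpa using pow_dvd_xDen_nsmul hp h n
  · simpa [xDen_neg] using pow_dvd_xDen_nsmul hp h n

/-- Integrality of `β_n`: for each prime power dividing the denominator of `P`, the points that
close to `O` are closed under addition and negation. -/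
lemma xDen_dvd_xDen_zsmul (n : ℤ) : xDen P ∣ xDen (n • P) := by
  rw [Nat.dvd_iff_prime_pow_dvd_dvd]
  intro p i hp h
  exact_mod_cast pow_dvd_xDen_zsmul hp (i := i) (by exact_mod_cast h) n

/-- The sequence `β_n` as a sequence of integers. -/
noncomputable def eds (P : (W.baseChange ℚ).toAffine.Point) (n : ℤ) : ℤ :=
  SignType.sign (psiAt W n P) * ((xDen (n • P) / xDen P : ℕ) : ℤ)

lemma psiAt_zero : psiAt W 0 P = 0 := by cases P <;> simp [psiAt]

lemma eds_zero : eds P 0 = 0 := by simp [eds, psiAt_zero]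

lemma eds_neg (n : ℤ) : eds P (-n) = -eds P n := by
  simp [eds, psiAt_neg, xDen_neg, Left.sign_neg]

lemma xDen_mul_eds (n : ℤ) :
    xDen P * eds P n = SignType.sign (psiAt W n P) * (xDen (n • P) : ℤ) := by
  obtain ⟨c, hc⟩ := xDen_dvd_xDen_zsmul (P := P) n
  rw [eds, hc]
  rcases Nat.eq_zero_or_pos (xDen P) with h | h
  · simp [h]
  · rw [Nat.mul_div_cancel_left _ h]; push_cast; ring

lemma ne_zero_of_not_isOfFinAddOrder (hP : ¬ IsOfFinAddOrder P) : P ≠ 0 := by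
  rintro rfl
  exact hP IsOfFinAddOrder.zero

lemma eds_cast (hP : ¬ IsOfFinAddOrder P) (n : ℤ) : (eds P n : ℚ) = edsb W P n := by
  rw [edsb]
  split_ifs with hn
  · simp [hn, eds_zero]
  have h0 := ne_zero_of_not_isOfFinAddOrder hP
  rw [denominator_eq h0, denominator_eq (zsmul_ne_zero_of_not_isOfFinAddOrder hP hn)]
  have hpos := xDen_pos h0
  rw [eq_div_iff (by positivity), mul_comm]
  have := congrArg (Int.cast : ℤ → ℚ) (xDen_mul_eds (P := P) n)
  push_cast at this
  convert this using 2

lemma sign_psiAt_sq (hP : ¬ IsOfFinAddOrder P) {n : ℤ} (hn : n ≠ 0) :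
    (SignType.sign (psiAt W n P) : ℤ) ^ 2 = 1 := by
  rcases lt_or_gt_of_ne (psiAt_ne_zero hP hn) with h | h
  · simp [sign_neg h]
  · simp [sign_pos h]

/-- The elliptic relation for the sequence `β_n`. -/
lemma eds_add_mul_eds_sub (hP : ¬ IsOfFinAddOrder P) {m : ℤ}
    (hm : ∀ p : ℕ, p.Prime → IsGoodAt p (m • P)) (n : ℤ) :
    eds P (n + m) * eds P (n - m) =
      xNum (m • P) * eds P n ^ 2 - xNum (n • P) * eds P m ^ 2 := by
  -- The sign formula needs nonzero indices; at `0` the relation holds thanks to the convention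
  -- `xNum 0 = 1`.
  rcases eq_or_ne n 0 with rfl | hn
  · simp only [zero_add, zero_sub, eds_neg, eds_zero, zero_zsmul, xNum_zero]; ring
  rcases eq_or_ne m 0 with rfl | hm0
  · simp only [add_zero, sub_zero, eds_zero, zero_zsmul, xNum_zero]; ring
  have h0 := xDen_pos (ne_zero_of_not_isOfFinAddOrder hP)
  have he : (xDen P : ℤ) ^ 2 ≠ 0 := by positivity
  refine mul_left_cancel₀ he ?_
  have s := sign_psiAt_mul hP hn hm0
  have a := sub_eq_xDen_mul_xDen (P := n • P) (Q := m • P) hm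
  have sn := sign_psiAt_sq hP hn
  have sm := sign_psiAt_sq hP hm0
  have e₁ := xDen_mul_eds (P := P) (n + m)
  have e₂ := xDen_mul_eds (P := P) (n - m)
  have e₃ := xDen_mul_eds (P := P) n
  have e₄ := xDen_mul_eds (P := P) m
  rw [add_zsmul] at e₁
  rw [sub_zsmul, ← sub_eq_add_neg] at e₂
  have ss := congrArg (fun z : SignType ↦ (z : ℤ)) s
  simp only [sign_mul, SignType.coe_mul] at ss
  rw [abs_sub_comm] at a
  have D := sign_mul_abs (xNum (m • P) * (xDen (n • P) : ℤ) ^ 2 - xNum (n • P) * (xDen (m • P) : ℤ) ^ 2)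
  rw [a, ← ss] at D
  calc (xDen P : ℤ) ^ 2 * (eds P (n + m) * eds P (n - m))
      = (xDen P * eds P (n + m)) * (xDen P * eds P (n - m)) := by ring
    _ = xNum (m • P) * (xDen (n • P) : ℤ) ^ 2 - xNum (n • P) * (xDen (m • P) : ℤ) ^ 2 := by
        rw [e₁, e₂, ← D]; ring
    _ = xNum (m • P) * (xDen P * eds P n) ^ 2 - xNum (n • P) * (xDen P * eds P m) ^ 2 := by
        rw [e₃, e₄, mul_pow, mul_pow, sn, sm]; ring
    _ = _ := by ring

lemma pow_dvd_eds_iff (hP : ¬ IsOfFinAddOrder P) (hp : p.Prime) {w : ℕ} {u : ℕ}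
    (hu : ¬ p ∣ u) (hw : xDen P = p ^ w * u) (j : ℕ) (n : ℤ) :
    (p : ℤ) ^ j ∣ eds P n ↔ (p : ℤ) ^ (j + w) ∣ xDen (n • P) := by
  rcases eq_or_ne n 0 with rfl | hn
  · simp [eds_zero, xDen_zero]
  have hp' := Nat.prime_iff_prime_int.1 hp
  have h := xDen_mul_eds (P := P) n
  have hs : IsUnit (SignType.sign (psiAt W n P) : ℤ) :=
    IsUnit.of_mul_eq_one _ ((pow_two _).symm.trans (sign_psiAt_sq hP hn))
  have hp0 : (p : ℤ) ^ w ≠ 0 := pow_ne_zero _ (by exact_mod_cast hp.ne_zero)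
  have hu' : ¬ (p : ℤ) ∣ u := by exact_mod_cast hu
  rw [← hs.dvd_mul_left (b := (xDen (n • P) : ℤ)), ← h, hw, add_comm, pow_add]
  push_cast
  rw [mul_assoc, mul_dvd_mul_iff_left hp0]
  exact ⟨fun h ↦ h.mul_left _, fun h ↦ hp'.pow_dvd_of_dvd_mul_left _ hu' h⟩

end WeierstrassCurve

/-! ### The integers `M`, `r(p^k)` and `π(p^k)` -/

namespace WeierstrassCurve

variable {W : WeierstrassCurve ℤ} {P : (W.baseChange ℚ).toAffine.Point} {p : ℕ} [Fact p.Prime]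

lemma nsmul_ne_zero_of_not_isOfFinAddOrder {A : Type*} [AddGroup A] {P : A}
    (hP : ¬ IsOfFinAddOrder P) {n : ℕ} (hn : 0 < n) : n • P ≠ 0 := fun h ↦
  hP (isOfFinAddOrder_iff_nsmul_eq_zero.2 ⟨n, hn, h⟩)

open scoped Classical in
lemma nsmul_toPadicPoint (n : ℕ) : n • toPadicPoint W p P = toPadicPoint W p (n • P) := by
  unfold toPadicPoint
  rw [map_nsmul]

lemma componentOrder_spec (hΔ : W.Δ ≠ 0) (hP : ¬ IsOfFinAddOrder P) :
    0 < componentOrder W p P ∧ IsGoodAt p (componentOrder W p P • P) := by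
  have hp : p.Prime := Fact.out
  -- A multiple reducing to `O` shows that the set is nonempty, so the infimum is not the default
  -- value `0`.
  obtain ⟨n, hn, hd⟩ := exists_pow_dvd_xDen_nsmul hΔ hp P 1
  have hne := nsmul_ne_zero_of_not_isOfFinAddOrder hP hn
  have hmem := Nat.sInf_mem (s := {n : ℕ | 0 < n ∧
      toPadicPoint W p (n • P) ∈ nonsingularReduction W p})
    ⟨n, hn, (mem_nonsingularReduction_iff hne).2 (isGoodAt_of_dvd_xDen hp (by simpa using hd))⟩
  have heq : componentOrder W p P = sInf {n : ℕ | 0 < n ∧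
      toPadicPoint W p (n • P) ∈ nonsingularReduction W p} := by
    simp only [componentOrder, OrderModulo, nsmul_toPadicPoint]
  rw [← heq] at hmem
  exact ⟨hmem.1, (mem_nonsingularReduction_iff
    (nsmul_ne_zero_of_not_isOfFinAddOrder hP hmem.1)).1 hmem.2⟩

lemma componentOrder_eq_one (hP : ¬ IsOfFinAddOrder P) (h : ¬ (p : ℤ) ∣ W.Δ) :
    componentOrder W p P = 1 := by
  have hp : p.Prime := Fact.out
  classical
  have hΔ : W.Δ ≠ 0 := fun h0 ↦ h (h0 ▸ dvd_zero _)
  refine le_antisymm (Nat.sInf_le ⟨one_pos, ?_⟩) (componentOrder_spec hΔ hP).1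
  rw [one_nsmul]
  exact (mem_nonsingularReduction_iff (ne_zero_of_not_isOfFinAddOrder hP)).2
    (isGoodAt_of_not_dvd_Δ hp h P)

lemma goodMultiple_spec (hΔ : W.Δ ≠ 0) (hP : ¬ IsOfFinAddOrder P) :
    0 < goodMultiple W P ∧ ∀ q : ℕ, q.Prime → IsGoodAt q (goodMultiple W P • P) := by
  classical
  let c : ℕ → ℕ := fun q ↦ if hq : q.Prime then
    haveI := Fact.mk hq; componentOrder W q P else 1
  have hmem : goodMultiple W P ∈ {m : ℕ | 0 < m ∧ ∀ (q : ℕ) [Fact q.Prime],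
      componentOrder W q P ∣ m} := by
    -- The witness is a product over the primes dividing `Δ`; at all other primes the order is `1`.
    refine Nat.sInf_mem ⟨∏ q ∈ W.Δ.natAbs.primeFactors, c q, Finset.prod_pos fun q hq ↦ ?_, ?_⟩
    · have hq' := Nat.prime_of_mem_primeFactors hq
      have := Fact.mk hq'
      simp only [c, hq', dif_pos]
      exact (componentOrder_spec hΔ hP).1
    · intro q hq
      by_cases hd : (q : ℤ) ∣ W.Δ
      · have hc : componentOrder W q P = c q := by simp [c, hq.out]
        rw [hc]
        exact Finset.dvd_prod_of_mem c (Nat.mem_primeFactors.2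
          ⟨hq.out, Int.natCast_dvd.1 hd, Int.natAbs_ne_zero.2 hΔ⟩)
      · rw [componentOrder_eq_one hP hd]
        exact one_dvd _
  refine ⟨hmem.1, fun q hq ↦ ?_⟩
  have := Fact.mk hq
  obtain ⟨d, hd⟩ := hmem.2 q
  rw [hd, mul_comm, mul_nsmul']
  exact (componentOrder_spec hΔ hP).2.nsmul hq d

lemma orderModPow_spec (hΔ : W.Δ ≠ 0) (hP : ¬ IsOfFinAddOrder P) {i : ℕ} (hi : 1 ≤ i) :
    0 < orderModPow W p i P ∧ (p : ℤ) ^ i ∣ xDen (orderModPow W p i P • P) := by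
  have hp : p.Prime := Fact.out
  obtain ⟨n, hn, hd⟩ := exists_pow_dvd_xDen_nsmul hΔ hp P i
  have hne := nsmul_ne_zero_of_not_isOfFinAddOrder hP hn
  have hmem := Nat.sInf_mem (s := {n : ℕ | 0 < n ∧
      toPadicPoint W p (n • P) ∈ padicFiltration W p i})
    ⟨n, hn, (mem_padicFiltration_iff hne hi).2 hd⟩
  have heq : orderModPow W p i P = sInf {n : ℕ | 0 < n ∧
      toPadicPoint W p (n • P) ∈ padicFiltration W p i} := by
    simp only [orderModPow, OrderModulo, nsmul_toPadicPoint]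
  rw [← heq] at hmem
  exact ⟨hmem.1, (mem_padicFiltration_iff
    (nsmul_ne_zero_of_not_isOfFinAddOrder hP hmem.1) hi).1 hmem.2⟩

lemma le_pointVal {Q : (W.baseChange ℚ).toAffine.Point} (hQ : Q ≠ 0) {i : ℕ}
    (h : (p : ℤ) ^ i ∣ xDen Q) : i ≤ pointVal W p (toPadicPoint W p Q) := by
  have hp : p.Prime := Fact.out
  rcases Nat.eq_zero_or_pos i with rfl | hi
  · exact Nat.zero_le _
  -- Boundedness of the set is essential: an unbounded supremum in `ℕ` would be `0`. If `p^j ∣ e`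
  -- with `e > 0`, then `j ≤ e`.
  refine le_csSup ⟨xDen Q, fun j hj ↦ ?_⟩ ((mem_padicFiltration_iff hQ hi).2 h)
  rcases Nat.eq_zero_or_pos j with rfl | hj0
  · exact Nat.zero_le _
  have hd : p ^ j ∣ xDen Q := by exact_mod_cast (mem_padicFiltration_iff hQ hj0).1 hj
  exact (Nat.lt_pow_self hp.one_lt).le.trans (Nat.le_of_dvd (xDen_pos hQ) hd)

/-- The factor `M` secures good reduction everywhere. The shift by `v_p(MP)`, which is at least the
valuation of the denominator of `P`, compensates for the division by `e_1` in `β`. -/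
lemma edsbRank_spec (hΔ : W.Δ ≠ 0) (hP : ¬ IsOfFinAddOrder P) {k : ℕ} (hk : 1 ≤ k) :
    0 < edsbRank W P p k ∧ (∀ q : ℕ, q.Prime → IsGoodAt q (edsbRank W P p k • P)) ∧
      ∀ w, (p : ℤ) ^ w ∣ xDen P → (p : ℤ) ^ (k + w) ∣ xDen (edsbRank W P p k • P) := by
  have hp : p.Prime := Fact.out
  obtain ⟨hM, hgood⟩ := goodMultiple_spec hΔ hP
  have hMP := nsmul_ne_zero_of_not_isOfFinAddOrder hP hM
  have hMP' : ¬ IsOfFinAddOrder (goodMultiple W P • P) := fun h ↦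
    hP (h.of_nsmul hM.ne')
  obtain ⟨h₁, h₂⟩ := orderModPow_spec (p := p) hΔ hMP'
    (i := k + pointVal W p (toPadicPoint W p (goodMultiple W P • P))) (by omega)
  rw [edsbRank]
  refine ⟨Nat.mul_pos hM h₁, fun q hq ↦ ?_, fun w hw ↦ ?_⟩
  · rw [mul_nsmul]
    exact (hgood q hq).nsmul hq _
  · rw [mul_nsmul]
    exact (pow_dvd_pow _ (Nat.add_le_add_left
      (le_pointVal hMP (pow_dvd_xDen_nsmul hp hw _)) k)).trans h₂

/-- The congruence of the sequence `β_n` modulo `p ^ k` at multiples of `r(p ^ k)`. -/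
lemma pow_dvd_eds_add_sub (hΔ : W.Δ ≠ 0) (hP : ¬ IsOfFinAddOrder P) {k N : ℕ} (hk : 1 ≤ k)
    (hN : (p ^ k).totient ∣ N)
    (hAN : (p : ℤ) ^ k ∣ xNum (edsbRank W P p k • P) ^ N.choose 2 - 1) (n : ℤ) :
    (p : ℤ) ^ k ∣ eds P (n + N * edsbRank W P p k) - eds P n := by
  have hp : p.Prime := Fact.out
  obtain ⟨-, hgood, hdvd⟩ := edsbRank_spec (p := p) hΔ hP hk
  obtain ⟨w, u, hu, hw⟩ := Nat.exists_eq_pow_mul_and_not_dvd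
    (xDen_pos (ne_zero_of_not_isOfFinAddOrder hP)).ne' p hp.ne_one
  have hr := hdvd w (by rw [hw]; push_cast; exact dvd_mul_right _ _)
  generalize edsbRank W P p k = r at *
  have hval := pow_dvd_eds_iff hP hp hu hw
  have hr' : (p : ℤ) ^ (k + w) ∣ xDen ((r : ℤ) • P) := by rwa [natCast_zsmul]
  have hβr := (hval k r).2 hr'
  have hA : ¬ (p : ℤ) ∣ xNum (r • P) :=
    not_dvd_xNum hp ((dvd_pow_self _ (by omega)).trans hr)
  refine dvd_sub_of_mul_sub_sq hp hA hN hAN (fun n ↦ ?_) (fun n j hj ↦ ?_) n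
  · have h := eds_add_mul_eds_sub hP (m := r) (by simpa using hgood) n
    rw [h, natCast_zsmul, sub_sub_cancel_left, dvd_neg, mul_comm 2 k, pow_mul]
    exact (pow_dvd_pow_of_dvd hβr 2).mul_left _
  · have hjr : (p : ℤ) ^ (j + w) ∣ xDen ((r : ℤ) • P) := (pow_dvd_pow _ (by omega)).trans hr'
    rw [hval, hval]
    refine ⟨fun h ↦ ?_, fun h ↦ ?_⟩
    · rw [add_zsmul]; exact pow_dvd_xDen_add hp h hjr
    · have := pow_dvd_xDen_add hp h (Q := -((r : ℤ) • P)) (by rwa [xDen_neg])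
      rwa [add_zsmul, add_neg_cancel_right] at this

lemma eds_modEq_of_modEq {q T : ℕ} (h : ∀ n, (q : ℤ) ∣ eds P (n + T) - eds P n) {m n : ℤ}
    (hmn : m ≡ n [ZMOD T]) : eds P m ≡ eds P n [ZMOD q] := by
  have hper : Function.Periodic (fun n ↦ (eds P n : ZMod q)) (T : ℤ) := fun n ↦
    ((ZMod.intCast_eq_intCast_iff_dvd_sub _ _ _).2 (h n)).symm
  obtain ⟨c, hc⟩ := hmn.dvd
  rw [← ZMod.intCast_eq_intCast_iff, show n = m + c * T by linear_combination hc]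
  exact (hper.int_mul c m).symm

/-- The elliptic relation at `n = M`, `m = r` reads `β_{M+r} β_{M-r} ≡ A β_M² mod p`, so `A` is a
square modulo `p`. Euler's criterion gives `A^((p-1)/2) ≡ 1 mod p`, and raising to the power
`p^(k-1)` lifts this to `p^k`. -/
lemma pow_dvd_xNum_pow_sub_one (hΔ : W.Δ ≠ 0) (hP : ¬ IsOfFinAddOrder P) {k : ℕ} (hk : 1 ≤ k)
    (h2 : p ≠ 2) (hleg : legendreSym p (eds P ((goodMultiple W P : ℤ) + (edsbRank W P p k : ℤ)) *
      eds P ((goodMultiple W P : ℤ) - (edsbRank W P p k : ℤ))) = 1) :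
    (p : ℤ) ^ k ∣ xNum (edsbRank W P p k • P) ^ ((p - 1) * p ^ (k - 1)).choose 2 - 1 := by
  have hp : p.Prime := Fact.out
  obtain ⟨-, hgood, hdvd⟩ := edsbRank_spec (p := p) hΔ hP hk
  obtain ⟨w, u, hu, hw⟩ := Nat.exists_eq_pow_mul_and_not_dvd
    (xDen_pos (ne_zero_of_not_isOfFinAddOrder hP)).ne' p hp.ne_one
  have hr := hdvd w (by rw [hw]; push_cast; exact dvd_mul_right _ _)
  generalize edsbRank W P p k = r at *
  have hβr := (pow_dvd_eds_iff hP hp hu hw k r).2 (by rwa [natCast_zsmul])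
  have hβr' : (eds P r : ZMod p) = 0 := by
    rw [ZMod.intCast_zmod_eq_zero_iff_dvd]
    exact (dvd_pow_self _ (by omega)).trans hβr
  rw [eds_add_mul_eds_sub hP (m := r) (by simpa using hgood), natCast_zsmul] at hleg
  generalize xNum (r • P) = A at *
  have heul := legendreSym.eq_pow p
    (A * eds P (goodMultiple W P) ^ 2 - xNum ((goodMultiple W P : ℤ) • P) * eds P r ^ 2)
  rw [hleg] at heul
  push_cast at heul
  rw [hβr'] at heul
  have hhalf : p - 1 = 2 * (p / 2) := by
    have := hp.eq_two_or_odd.resolve_left h2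
    omega
  have hp2 : 0 < p / 2 := Nat.div_pos hp.two_le two_pos
  have hβM : (eds P (goodMultiple W P) : ZMod p) ≠ 0 := by
    intro h0
    simp [h0, hp2.ne'] at heul
  have hA : (p : ℤ) ∣ A ^ (p / 2) - 1 := by
    rw [← ZMod.intCast_zmod_eq_zero_iff_dvd]
    push_cast
    have hf := ZMod.pow_card_sub_one_eq_one hβM
    rw [hhalf, pow_mul] at hf
    rw [zero_pow two_ne_zero, mul_zero, sub_zero, mul_pow, hf, mul_one] at heul
    rw [← heul, sub_self]
  have hlift := dvd_sub_pow_of_dvd_sub hA (k - 1)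
  rw [Nat.sub_add_cancel hk, one_pow, ← pow_mul] at hlift
  -- The binomial coefficient is a multiple of only half of `φ(p^k)`, which is exactly what the
  -- residue condition makes sufficient.
  have hch : ((p - 1) * p ^ (k - 1)).choose 2 =
      (p / 2 * p ^ (k - 1)) * ((p - 1) * p ^ (k - 1) - 1) := by
    rw [Nat.choose_two_right, hhalf, mul_assoc 2, mul_assoc 2, Nat.mul_div_cancel_left _ two_pos]
  rw [hch, pow_mul]
  exact hlift.trans (sub_one_dvd_pow_sub_one _ _)

lemma edsbPeriod_spec (hΔ : W.Δ ≠ 0) (hP : ¬ IsOfFinAddOrder P) {k : ℕ} (hk : 1 ≤ k) :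
    0 < edsbPeriod W P (eds P) p k ∧ ∀ n,
      (p : ℤ) ^ k ∣ eds P (n + edsbPeriod W P (eds P) p k) - eds P n := by
  have hp : p.Prime := Fact.out
  obtain ⟨hr, -, hdvd⟩ := edsbRank_spec (p := p) hΔ hP hk
  have h1 : 0 < p - 1 := Nat.sub_pos_of_lt hp.one_lt
  have hpk : 0 < p ^ (k - 1) := pow_pos hp.pos _
  have htot : (p ^ k).totient = (p - 1) * p ^ (k - 1) := by
    rw [Nat.totient_prime_pow hp hk, mul_comm]
  rw [edsbPeriod]
  split_ifs with h
  · refine ⟨by positivity, fun n ↦ ?_⟩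
    have := pow_dvd_eds_add_sub hΔ hP hk htot.dvd (pow_dvd_xNum_pow_sub_one hΔ hP hk h.1 h.2) n
    push_cast at this ⊢
    exact this
  · refine ⟨by positivity, fun n ↦ ?_⟩
    have := pow_dvd_eds_add_sub (N := 2 * ((p - 1) * p ^ (k - 1))) hΔ hP hk
      (by rw [htot]; exact dvd_mul_left _ _) ?_ n
    · push_cast at this ⊢
      rw [mul_assoc 2]
      exact this
    -- With `N = 2 φ(p^k)`, the coefficient `N choose 2` equals `φ(p^k) (N - 1)`, so Euler's theorem
    -- suffices without a residue condition.
    · rw [Nat.choose_two_right, mul_assoc 2, Nat.mul_div_cancel_left _ two_pos, pow_mul]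
      refine Dvd.dvd.trans ?_ (sub_one_dvd_pow_sub_one _ _)
      rw [← htot]
      have hA : ¬ (p : ℤ) ∣ xNum (edsbRank W P p k • P) :=
        not_dvd_xNum hp ((dvd_pow_self _ (by omega)).trans (hdvd 0 (by simp)))
      have hu : IsUnit ((xNum (edsbRank W P p k • P) : ℤ) : ZMod (p ^ k)) := by
        rw [ZMod.coe_int_isUnit_iff_isCoprime]
        push_cast
        exact ((Nat.prime_iff_prime_int.1 hp).coprime_iff_not_dvd.2 hA).pow_left
      have hone := congrArg Units.val (ZMod.pow_totient hu.unit)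
      rw [Units.val_pow_eq_pow_val, IsUnit.unit_spec, Units.val_one] at hone
      have h' := (ZMod.intCast_eq_intCast_iff_dvd_sub 1
        (xNum (edsbRank W P p k • P) ^ (p ^ k).totient) (p ^ k)).1 (by
          rw [Int.cast_one, Int.cast_pow, hone])
      exact_mod_cast h'

end WeierstrassCurve

theorem proposition3p5 (W : WeierstrassCurve ℤ) [(W.baseChange ℚ).IsElliptic]
    (P : (W.baseChange ℚ).toAffine.Point) (hP : ¬ IsOfFinAddOrder P) :
    ∃ β : ℤ → ℤ, (∀ n : ℤ, (β n : ℚ) = WeierstrassCurve.edsb W P n) ∧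
      (∀ (p : ℕ) [Fact p.Prime] (k : ℕ), 1 ≤ k →
        0 < WeierstrassCurve.edsbPeriod W P β p k ∧
        ∀ m n : ℤ, m ≡ n [ZMOD (WeierstrassCurve.edsbPeriod W P β p k : ℤ)] →
          β m ≡ β n [ZMOD (p : ℤ) ^ k]) ∧
      (∀ N : ℕ, 1 ≤ N → ∃ T : ℕ, 0 < T ∧ ∀ m n : ℤ, m ≡ n [ZMOD (T : ℤ)] →
        β m ≡ β n [ZMOD (N : ℤ)]) := by
  have hΔ := W.Δ_ne_zero_of_isElliptic_baseChange
  have hprime (p : ℕ) [Fact p.Prime] (k : ℕ) (hk : 1 ≤ k) :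
      0 < WeierstrassCurve.edsbPeriod W P (WeierstrassCurve.eds P) p k ∧
        ∀ m n : ℤ, m ≡ n [ZMOD (WeierstrassCurve.edsbPeriod W P (WeierstrassCurve.eds P) p k : ℤ)] →
          WeierstrassCurve.eds P m ≡ WeierstrassCurve.eds P n [ZMOD (p : ℤ) ^ k] := by
    obtain ⟨h₁, h₂⟩ := WeierstrassCurve.edsbPeriod_spec (p := p) hΔ hP hk
    refine ⟨h₁, fun m n hmn ↦ ?_⟩
    have := WeierstrassCurve.eds_modEq_of_modEq (q := p ^ k) (by exact_mod_cast h₂) hmn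
    exact_mod_cast this
  refine ⟨WeierstrassCurve.eds P, WeierstrassCurve.eds_cast hP, hprime, fun N hN ↦ ?_⟩
  induction N using Nat.recOnPrimeCoprime with
  | zero => omega
  | prime_pow p k hp =>
    rcases Nat.eq_zero_or_pos k with rfl | hk
    · exact ⟨1, one_pos, fun m n _ ↦ by simpa using Int.modEq_one⟩
    · have := Fact.mk hp
      obtain ⟨h₁, h₂⟩ := hprime p k hk
      exact ⟨_, h₁, by exact_mod_cast h₂⟩
  | coprime a b ha hb hab iha ihb =>
    obtain ⟨S, hS, hS'⟩ := iha (by omega)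
    obtain ⟨T, hT, hT'⟩ := ihb (by omega)
    refine ⟨S * T, Nat.mul_pos hS hT, fun m n hmn ↦ ?_⟩
    push_cast at hmn ⊢
    rw [← Int.modEq_and_modEq_iff_modEq_mul (by simpa using hab)]
    exact ⟨hS' m n (hmn.of_mul_right _), hT' m n (hmn.of_mul_left _)⟩
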